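/- A subset $A\subseteq\mathbb{N}$ (a "real") has density $1$ if $\lim_{n\to\infty}|A\cap\{0,\dots,n-1\}|/n=1$. A real $C$ is generically computable (respectively, generically $A$-computable) if there is a partial recursive (respectively, partial $A$-recursive) function $\varphi$ with values in $\{0,1\}$ whose domain has density $1$ and such that $\varphi(n)=1$ implies $n\in C$ and $\varphi(n)=0$ implies $n\notin C$. Two reals $A$ and $B$ form a minimal pair for generic computability if neither of them is recursive and every real that is both generically $A$-computable and generically $B$-computable is generically computable. Proposition. Let $A,B\subseteq\mathbb{N}$. If $A$ is $\Delta^0_2$ and $B$ is not $\Delta^0_2$, then $A$ and $B$ do not form a minimal pair for generic computability. (That is, if moreover $A$ is nonrecursive, then there is a real $C$ that is not generically computable but is both generically $A$-computable and generically $B$-computable.) -/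

import Mathlib

open Filter Topology

namespace GenericComputability

/-- A set of natural numbers ("real") is recursive if it is decidable by an algorithm. -/
def IsRecursive (A : Set ℕ) : Prop :=
  ComputablePred fun n : ℕ => n ∈ A

open Classical in
/-- The characteristic function of `A`, with values `0` and `1`. -/
noncomputable def charFun (A : Set ℕ) (n : ℕ) : ℕ :=
  if n ∈ A then 1 else 0

/-- The total characteristic function of `A`, as an oracle. -/
noncomputable def oracle (A : Set ℕ) : ℕ →. ℕ :=
  fun n => Part.some (charFun A n)

/-- `A` has density 1: `|A ∩ {0, …, n - 1}| / n → 1` as `n → ∞`. -/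
def HasDensityOne (A : Set ℕ) : Prop :=
  Tendsto (fun n : ℕ => ((A ∩ Set.Iio n).ncard : ℝ) / (n : ℝ)) atTop (𝓝 1)

/-- The partial function `φ` has density-1 domain, and each of its values is the correct bit
(`0` or `1`) of `A`. -/
def GenericallyDescribes (φ : ℕ →. ℕ) (A : Set ℕ) : Prop :=
  HasDensityOne φ.Dom ∧ ∀ n, ∀ v ∈ φ n, v = charFun A n

/-- `A` is generically computable. -/
def GenericallyComputable (A : Set ℕ) : Prop :=
  ∃ φ : ℕ →. ℕ, Nat.Partrec φ ∧ GenericallyDescribes φ A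

/-- `A` is generically `B`-computable: it is generically computable using `B` as an oracle. -/
def GenericallyComputableIn (B A : Set ℕ) : Prop :=
  ∃ φ : ℕ →. ℕ, Nat.RecursiveIn {oracle B} φ ∧ GenericallyDescribes φ A

/-- `A` and `B` form a minimal pair for generic computability: neither is recursive, and every
real that is both generically `A`-computable and generically `B`-computable is generically
computable. -/
def IsMinimalPair (A B : Set ℕ) : Prop :=
  ¬ IsRecursive A ∧ ¬ IsRecursive B ∧
    ∀ C : Set ℕ, GenericallyComputableIn A C → GenericallyComputableIn B C →
      GenericallyComputable C

/-- `A` is `Σ⁰₂`: `n ∈ A ↔ ∃ x, ∀ y, R n x y` for a recursive relation `R`. -/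
def IsSigma02 (A : Set ℕ) : Prop :=
  ∃ R : ℕ → ℕ → ℕ → Prop,
    ComputablePred (fun p : ℕ × ℕ × ℕ => R p.1 p.2.1 p.2.2) ∧
      ∀ n, n ∈ A ↔ ∃ x, ∀ y, R n x y

/-- `A` is `Π⁰₂`: `n ∈ A ↔ ∀ x, ∃ y, R n x y` for a recursive relation `R`. -/
def IsPi02 (A : Set ℕ) : Prop :=
  ∃ R : ℕ → ℕ → ℕ → Prop,
    ComputablePred (fun p : ℕ × ℕ × ℕ => R p.1 p.2.1 p.2.2) ∧
      ∀ n, n ∈ A ↔ ∀ x, ∃ y, R n x y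

/-- `A` is `Δ⁰₂`: it is both `Σ⁰₂` and `Π⁰₂`. -/
def IsDelta02 (A : Set ℕ) : Prop :=
  IsSigma02 A ∧ IsPi02 A

end GenericComputability

namespace GenericComputability

/-! ### Primitive recursive predicates -/

section PrimrecTools

variable {α : Type*} [Primcodable α]

/-! Both generic computations output only `0`. It is enough to find density-one sets, r.e. in `A`
and in `B`, such that every r.e. set of density one has infinitely many elements outside both. A set
`C` inside the common complement then diagonalizes against all programs.

Fix an r.e. set `W` and a number `p`, and split each dyadic block into residue classes modulo `2 ^
p`. In a block assigned to a list of at most `2 ^ p` strings, an oracle extending the `j`-th string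
omits the class `j`. `W` responds when it meets half of the classes, and one element of `W` per
class met is then chosen. `A` recognises stages at which the approximation to its first `m` bits is
correct, and at such a stage it enumerates whatever is not chosen. So the choice survives if the
response precedes the first correct stage (permission). If one list used infinitely many blocks
without permission, the responses would bound the correct stages and `A` would be recursive
(`isRecursive_of_infinite_records`).

After a permitted response, a string whose class was met has succeeded: an element of `W` is omitted
by `A` and by each oracle that follows the string. The other strings, at most half of `2 ^ p`, are
extended by both bits, so the width stays bounded (`length_children_le`). An oracle that stays
active forever follows a path isolated in a tree of bounded width whose levels are limits of
computable approximations, so it is `Δ⁰₂` (`isDelta02_of_infinite_active`). Hence `B` omits only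
finitely much for each `p`, and must leave the tree through a class that was met
(`exists_mem_omitted`). `A` omits at most `2 ^ p` elements per block. As the relative frequencies
are at most `2 * 2 ^ (-p)`, the union over `p` still has density zero
(`hasDensityOne_of_compl_subset`). -/

theorem primrecPred_ball_lt {f : α → ℕ} {R : α → ℕ → Prop} (hf : Primrec f)
    (hR : PrimrecPred fun q : α × ℕ => R q.1 q.2) : PrimrecPred fun a => ∀ x < f a, R a x := by
  have h : PrimrecRel fun (x : ℕ) (a : α) => R a x :=
    PrimrecPred.comp (p := fun q : α × ℕ => R q.1 q.2) hR (Primrec.pair Primrec.snd Primrec.fst)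
  exact ((h.forall_mem_list).comp (Primrec.list_range.comp hf) Primrec.id).of_eq (by simp)

theorem primrecPred_bex_lt {f : α → ℕ} {R : α → ℕ → Prop} (hf : Primrec f)
    (hR : PrimrecPred fun q : α × ℕ => R q.1 q.2) : PrimrecPred fun a => ∃ x < f a, R a x := by
  have h : PrimrecRel fun (x : ℕ) (a : α) => R a x :=
    PrimrecPred.comp (p := fun q : α × ℕ => R q.1 q.2) hR (Primrec.pair Primrec.snd Primrec.fst)
  exact ((h.exists_mem_list).comp (Primrec.list_range.comp hf) Primrec.id).of_eq (by simp)

theorem primrecPred_ball_mem {β : Type*} [Primcodable β] {f : α → List β} {R : α → β → Prop}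
    (hf : Primrec f) (hR : PrimrecPred fun q : α × β => R q.1 q.2) :
    PrimrecPred fun a => ∀ x ∈ f a, R a x := by
  have h : PrimrecRel fun (x : β) (a : α) => R a x :=
    PrimrecPred.comp (p := fun q : α × β => R q.1 q.2) hR (Primrec.pair Primrec.snd Primrec.fst)
  exact (h.forall_mem_list).comp hf Primrec.id

theorem primrecPred_imp {p q : α → Prop} (hp : PrimrecPred p) (hq : PrimrecPred q) :
    PrimrecPred fun a => p a → q a :=
  (hp.not.or hq).of_eq fun a => by tauto

theorem primrec_pow : Primrec₂ ((· ^ ·) : ℕ → ℕ → ℕ) :=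
  Primrec₂.unpaired'.1 Nat.Primrec.pow

theorem rePred_exists_of_primrecPred {P : α → ℕ → Prop}
    (hP : PrimrecPred fun q : α × ℕ => P q.1 q.2) : REPred fun a => ∃ w, P a w := by
  classical
  have h : Partrec fun a => Nat.rfind fun w => Part.some (decide (P a w)) :=
    Partrec.rfind hP.computablePred.decide.partrec
  refine h.dom_re.of_eq fun a => ?_
  rw [@Nat.rfind_dom (fun w => Part.some (decide (P a w)) : ℕ →. Bool)]
  simp

end PrimrecTools

/-! ### Arithmetical hierarchy -/

/-- A `Π⁰₁` predicate has a primitive recursive matrix that is decreasing in the quantified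
variable. -/
theorem exists_primrecPred_antitone {R : ℕ → ℕ → ℕ → Prop}
    (hR : ComputablePred fun p : ℕ × ℕ × ℕ => R p.1 p.2.1 p.2.2) :
    ∃ G : ℕ → ℕ → ℕ → Prop, (PrimrecPred fun p : ℕ × ℕ × ℕ => G p.1 p.2.1 p.2.2) ∧
      (∀ n x s t, s ≤ t → G n x t → G n x s) ∧
      ∀ n x, (∀ y, R n x y) ↔ ∀ s, G n x s := by
  classical
  have h1 : Computable fun q : ℕ => decide (R q.unpair.1 q.unpair.2.unpair.1 q.unpair.2.unpair.2) :=
    hR.decide.comp (f := fun p : ℕ × ℕ × ℕ => decide (R p.1 p.2.1 p.2.2))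
      (g := fun q : ℕ => (q.unpair.1, q.unpair.2.unpair.1, q.unpair.2.unpair.2))
      ((Computable.fst.comp Computable.unpair).pair
        (Computable.unpair.comp (Computable.snd.comp Computable.unpair)))
  have h2 : Computable fun q : ℕ =>
      Encodable.encode (decide (R q.unpair.1 q.unpair.2.unpair.1 q.unpair.2.unpair.2)) :=
    Computable.encode.comp h1
  obtain ⟨c, hc⟩ := Nat.Partrec.Code.exists_code.1 (Partrec.nat_iff.1 h2.partrec)
  have hev : ∀ n x y v, v ∈ c.eval (Nat.pair n (Nat.pair x y)) ↔
      v = Encodable.encode (decide (R n x y)) := by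
    intro n x y v
    rw [hc]; simp
  -- `s` computation steps refute no instance `y < s`; the value `0` is the code of `false`.
  refine ⟨fun n x s => ∀ y < s, ¬ Nat.Partrec.Code.evaln s c (Nat.pair n (Nat.pair x y)) = some 0,
    ?_, ?_, ?_⟩
  · refine primrecPred_ball_lt (α := ℕ × ℕ × ℕ) (f := fun p => p.2.2)
      (R := fun p y => ¬ Nat.Partrec.Code.evaln p.2.2 c (Nat.pair p.1 (Nat.pair p.2.1 y)) = some 0)
      (Primrec.snd.comp Primrec.snd) ?_
    refine PrimrecPred.not (PrimrecRel.comp Primrec.eq ?_ (Primrec.const _))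
    refine Nat.Partrec.Code.primrec_evaln.comp (Primrec.pair (Primrec.pair
      (Primrec.snd.comp (Primrec.snd.comp Primrec.fst)) (Primrec.const c)) ?_)
    exact Primrec₂.natPair.comp (Primrec.fst.comp Primrec.fst)
      (Primrec₂.natPair.comp (Primrec.fst.comp (Primrec.snd.comp Primrec.fst)) Primrec.snd)
  · intro n x s t hst h y hy h0
    exact h y (hy.trans_le hst) (Nat.Partrec.Code.evaln_mono hst h0)
  · intro n x
    constructor
    · intro h s y _ h0
      have := (hev n x y 0).1 (Nat.Partrec.Code.evaln_sound h0)
      simp [h y] at this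
    · intro h y
      by_contra hy
      have : 0 ∈ c.eval (Nat.pair n (Nat.pair x y)) := (hev n x y 0).2 (by simp [hy])
      obtain ⟨k, hk⟩ := Nat.Partrec.Code.evaln_complete.1 this
      exact h (max k (y + 1)) y (by omega) (Nat.Partrec.Code.evaln_mono (le_max_left _ _) hk)

/-- A `Δ⁰₂` set is the pointwise limit of a primitive recursive sequence of predicates. -/
theorem IsDelta02.exists_approx {A : Set ℕ} (hA : IsDelta02 A) :
    ∃ a : ℕ → ℕ → Bool, Primrec₂ a ∧ ∀ n, ∀ᶠ s in atTop, (a s n = true ↔ n ∈ A) := by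
  classical
  obtain ⟨⟨R₁, hR₁, h₁⟩, R₂, hR₂, h₂⟩ := hA
  obtain ⟨G₁, hG₁, m₁, e₁⟩ := exists_primrecPred_antitone hR₁
  obtain ⟨G₂, hG₂, m₂, e₂⟩ := exists_primrecPred_antitone (R := fun n x y => ¬ R₂ n x y) hR₂.not
  have hP : PrimrecPred fun q : ℕ × ℕ =>
      ∃ x < q.1 + 1, G₁ q.2 x q.1 ∧ ∀ x' < x, ¬ G₂ q.2 x' q.1 := by
    refine primrecPred_bex_lt (α := ℕ × ℕ) (f := fun q => q.1 + 1)
      (R := fun q x => G₁ q.2 x q.1 ∧ ∀ x' < x, ¬ G₂ q.2 x' q.1)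
      (Primrec.succ.comp Primrec.fst) (PrimrecPred.and ?_ ?_)
    · exact hG₁.comp (f := fun r : (ℕ × ℕ) × ℕ => (r.1.2, r.2, r.1.1))
        ((Primrec.snd.comp Primrec.fst).pair
          (Primrec.snd.pair (Primrec.fst.comp Primrec.fst)))
    · refine primrecPred_ball_lt (α := (ℕ × ℕ) × ℕ) (f := fun r => r.2)
        (R := fun r x' => ¬ G₂ r.1.2 x' r.1.1) Primrec.snd (PrimrecPred.not ?_)
      exact hG₂.comp (f := fun r : ((ℕ × ℕ) × ℕ) × ℕ => (r.1.1.2, r.2, r.1.1.1))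
        ((Primrec.snd.comp (Primrec.fst.comp Primrec.fst)).pair
          (Primrec.snd.pair (Primrec.fst.comp (Primrec.fst.comp Primrec.fst))))
  -- A race of witnesses: guess `n ∈ A` if some unrefuted witness for `A` has no smaller unrefuted
  -- witness for the complement. False witnesses are eventually refuted, so the side with a true one
  -- wins.
  refine ⟨fun s n => decide (∃ x < s + 1, G₁ n x s ∧ ∀ x' < x, ¬ G₂ n x' s), hP.decide, ?_⟩
  intro n
  have aux : ∀ (G : ℕ → ℕ → ℕ → Prop), (∀ n x s t, s ≤ t → G n x t → G n x s) →
      ∀ k, (∀ x < k, ¬ ∀ s, G n x s) → ∀ᶠ s in atTop, ∀ x < k, ¬ G n x s := by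
    intro G hm k hk
    have : ∀ᶠ s in atTop, ∀ x ∈ Finset.range k, ¬ G n x s := by
      rw [Filter.eventually_all_finset]
      intro x hx
      have := hk x (Finset.mem_range.1 hx)
      push Not at this
      obtain ⟨s, hs⟩ := this
      filter_upwards [eventually_ge_atTop s] with t ht hG
      exact hs (hm n x s t ht hG)
    filter_upwards [this] with s hs x hx
    exact hs x (Finset.mem_range.2 hx)
  by_cases hn : n ∈ A
  · obtain ⟨x, hx⟩ := (h₁ n).1 hn
    have hx' := (e₁ n x).1 hx
    have hno : ∀ x' < x, ¬ ∀ s, G₂ n x' s := by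
      intro x' _ h
      obtain ⟨y, hy⟩ := (h₂ n).1 hn x'
      exact (e₂ n x').2 h y hy
    filter_upwards [aux G₂ m₂ x hno, eventually_ge_atTop x] with s hs hxs
    simp only [decide_eq_true_eq, hn, iff_true]
    exact ⟨x, by omega, hx' s, hs⟩
  · have : ∃ x, ∀ y, ¬ R₂ n x y := by
      by_contra hcon
      push Not at hcon
      exact hn ((h₂ n).2 hcon)
    obtain ⟨x, hx⟩ := this
    have hx' := (e₂ n x).1 hx
    have hno : ∀ x' < x + 1, ¬ ∀ s, G₁ n x' s := by
      intro x' _ h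
      exact hn ((h₁ n).2 ⟨x', (e₁ n x').2 h⟩)
    filter_upwards [aux G₁ m₁ (x + 1) hno] with s hs
    simp only [decide_eq_true_eq, hn, iff_false]
    rintro ⟨z, -, hz, hz'⟩
    rcases Nat.lt_or_ge z (x + 1) with h | h
    · exact hs z h hz
    · exact hz' x (by omega) (hx' s)

/-- A set is `Σ⁰₂` if membership is the eventual truth of a primitive recursive relation. -/
theorem isSigma02_of_eventually {A : Set ℕ} {P : ℕ → ℕ → ℕ → Prop}
    (hP : PrimrecPred fun q : ℕ × ℕ × ℕ => P q.1 q.2.1 q.2.2)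
    (h : ∀ n, n ∈ A ↔ ∃ k, ∀ᶠ s in atTop, P n k s) : IsSigma02 A := by
  refine ⟨fun n x y => P n x.unpair.1 (x.unpair.2 + y), PrimrecPred.computablePred ?_, ?_⟩
  · refine hP.comp (f := fun q : ℕ × ℕ × ℕ => (q.1, q.2.1.unpair.1, q.2.1.unpair.2 + q.2.2))
      (Primrec.fst.pair (Primrec.pair ?_ (Primrec.nat_add.comp ?_ ?_)))
    · exact Primrec.fst.comp (Primrec.unpair.comp (Primrec.fst.comp Primrec.snd))
    · exact Primrec.snd.comp (Primrec.unpair.comp (Primrec.fst.comp Primrec.snd))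
    · exact Primrec.snd.comp Primrec.snd
  · intro n
    rw [h]
    constructor
    · rintro ⟨k, hk⟩
      obtain ⟨s, hs⟩ := eventually_atTop.1 hk
      refine ⟨Nat.pair k s, fun y => ?_⟩
      simpa using hs (s + y) (by omega)
    · rintro ⟨x, hx⟩
      refine ⟨x.unpair.1, eventually_atTop.2 ⟨x.unpair.2, fun s hs => ?_⟩⟩
      have : P n x.unpair.1 (x.unpair.2 + (s - x.unpair.2)) := hx (s - x.unpair.2)
      rwa [Nat.add_sub_cancel' hs] at this

theorem IsSigma02.isPi02_of_compl {A : Set ℕ} (h : IsSigma02 Aᶜ) : IsPi02 A := by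
  obtain ⟨R, hR, h⟩ := h
  refine ⟨fun n x y => ¬ R n x y, hR.not, fun n => ?_⟩
  have := h n
  rw [Set.mem_compl_iff] at this
  rw [← not_iff_not, this]
  push Not
  rfl

/-- A set is recursive if a search through a primitive recursive relation always finds a
witness, and each witness decides membership correctly. -/
theorem isRecursive_of_search {A : Set ℕ} {P : ℕ → ℕ → Prop} {val : ℕ → ℕ → Bool}
    (hP : PrimrecPred fun q : ℕ × ℕ => P q.1 q.2) (hval : Primrec₂ val)
    (hex : ∀ n, ∃ w, P n w) (hc : ∀ n w, P n w → (val n w = true ↔ n ∈ A)) : IsRecursive A := by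
  refine ComputablePred.computable_iff_re_compl_re'.2 ⟨?_, ?_⟩
  · refine (rePred_exists_of_primrecPred (P := fun n w => P n w ∧ val n w = true)
      (hP.and (PrimrecRel.comp Primrec.eq hval (Primrec.const true)))).of_eq fun n => ?_
    constructor
    · rintro ⟨w, h1, h2⟩
      exact (hc n w h1).1 h2
    · intro h
      obtain ⟨w, hw⟩ := hex n
      exact ⟨w, hw, (hc n w hw).2 h⟩
  · refine (rePred_exists_of_primrecPred (P := fun n w => P n w ∧ ¬ val n w = true)
      (hP.and (PrimrecPred.not
        (PrimrecRel.comp Primrec.eq hval (Primrec.const true))))).of_eq fun n => ?_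
    constructor
    · rintro ⟨w, h1, h2⟩ h
      exact h2 ((hc n w h1).2 h)
    · intro h
      obtain ⟨w, hw⟩ := hex n
      exact ⟨w, hw, fun h' => h ((hc n w hw).1 h')⟩

/-! ### Oracle computations -/

open Classical in
/-- The initial segment of length `n` of the characteristic sequence of `X`. -/
noncomputable def initSeg (X : Set ℕ) (n : ℕ) : List Bool :=
  (List.range n).map fun i => decide (i ∈ X)

theorem length_initSeg (X : Set ℕ) (n : ℕ) : (initSeg X n).length = n := by
  simp [initSeg]

theorem initSeg_succ (X : Set ℕ) (n : ℕ) :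
    ∃ b, initSeg X (n + 1) = initSeg X n ++ [b] ∧ (b = true ↔ n ∈ X) := by
  classical
  exact ⟨decide (n ∈ X), by simp [initSeg, List.range_succ], by simp⟩

theorem getElem?_initSeg {X : Set ℕ} {n i : ℕ} (h : i < n) :
    ∃ b, (initSeg X n)[i]? = some b ∧ (b = true ↔ i ∈ X) := by
  classical
  exact ⟨decide (i ∈ X), by simp [initSeg, h], by simp⟩

theorem take_initSeg (X : Set ℕ) {m n : ℕ} (h : m ≤ n) :
    (initSeg X n).take m = initSeg X m := by
  simp [initSeg, ← List.map_take, List.take_range, h]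

/-- The initial segments of `X` are uniformly computable from `X`. -/
theorem recursiveIn_initSeg (X : Set ℕ) :
    Nat.RecursiveIn {oracle X} fun n => Part.some (Encodable.encode (initSeg X n)) := by
  classical
  let st : ℕ → ℕ := fun q =>
    Encodable.encode ((((Encodable.decode (α := List Bool) q.unpair.1).getD []) ++
      [q.unpair.2 == 1] : List Bool))
  have hst : Nat.Primrec st := by
    rw [← Primrec.nat_iff]
    refine Primrec.encode.comp (Primrec.list_concat.comp (Primrec.option_getD.comp
      (Primrec.decode.comp (Primrec.fst.comp Primrec.unpair)) (Primrec.const [])) ?_)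
    exact Primrec.beq.comp (Primrec.snd.comp Primrec.unpair) (Primrec.const 1)
  have hor : Nat.RecursiveIn {oracle X} (oracle X) := .oracle _ rfl
  have hy : Nat.RecursiveIn {oracle X} (fun q : ℕ => Part.some (q.unpair.2.unpair.1)) :=
    Nat.RecursiveIn.of_eq (Nat.RecursiveIn.comp .left .right) (by intro n; simp)
  have hi : Nat.RecursiveIn {oracle X} (fun q : ℕ => Part.some (q.unpair.2.unpair.2)) :=
    Nat.RecursiveIn.of_eq (Nat.RecursiveIn.comp .right .right) (by intro n; simp)
  have hb := Nat.RecursiveIn.comp hst.recursiveIn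
    (Nat.RecursiveIn.pair hi (Nat.RecursiveIn.comp hor hy))
  have h0 : Nat.RecursiveIn {oracle X} (fun _ => Part.some (Encodable.encode ([] : List Bool))) :=
    (Nat.Primrec.const _).recursiveIn
  have hrec := Nat.RecursiveIn.prec h0 hb
  have hid : Nat.RecursiveIn {oracle X} (fun n : ℕ => Part.some n) :=
    (Nat.Primrec.id).recursiveIn
  have hz : Nat.RecursiveIn {oracle X} (fun _ : ℕ => Part.some 0) :=
    (Nat.Primrec.const 0).recursiveIn
  refine Nat.RecursiveIn.of_eq (Nat.RecursiveIn.comp hrec (Nat.RecursiveIn.pair hz hid)) ?_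
  have hval : ∀ y, (Part.some y >>= oracle X) = Part.some (charFun X y) :=
    fun y => Part.bind_some _ _
  intro n
  simp only [Seq.seq, Part.coe_some, Part.bind_eq_bind, Part.map_eq_map, Part.map_some,
    Part.bind_some, Nat.unpair_pair, hval]
  induction n with
  | zero => simp [initSeg]
  | succ n ih =>
    refine (congrArg (fun z : Part ℕ => z.bind fun i =>
      Part.some (st (Nat.pair i (charFun X n)))) ih).trans ?_
    simp only [Part.bind_some, st, Nat.unpair_pair, Encodable.encodek, Option.getD_some]
    by_cases h : n ∈ X <;> simp [h, charFun, initSeg, List.range_succ]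

/-- The partial function with value `0` on a set that is recursively enumerable in `X` is
recursive in `X`. -/
theorem exists_recursiveIn_dom (X : Set ℕ) {R : ℕ → ℕ → List Bool → Prop}
    (hR : PrimrecPred fun q : ℕ × ℕ × List Bool => R q.1 q.2.1 q.2.2) :
    ∃ φ : ℕ →. ℕ, Nat.RecursiveIn {oracle X} φ ∧
      φ.Dom = {x | ∃ s, R x s (initSeg X s)} ∧ ∀ x, ∀ v ∈ φ x, v = 0 := by
  classical
  let f : ℕ → ℕ := fun q =>
    if R q.unpair.1.unpair.1 q.unpair.1.unpair.2
      ((Encodable.decode (α := List Bool) q.unpair.2).getD []) then 0 else 1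
  have hf : Nat.Primrec f := by
    rw [← Primrec.nat_iff]
    refine Primrec.ite ?_ (Primrec.const 0) (Primrec.const 1)
    refine hR.comp (f := fun q : ℕ => (q.unpair.1.unpair.1, q.unpair.1.unpair.2,
      (Encodable.decode (α := List Bool) q.unpair.2).getD [])) ?_
    have h1 : Primrec fun q : ℕ => q.unpair.1.unpair :=
      Primrec.unpair.comp (Primrec.fst.comp Primrec.unpair)
    exact (Primrec.fst.comp h1).pair ((Primrec.snd.comp h1).pair (Primrec.option_getD.comp
      (Primrec.decode.comp (Primrec.snd.comp Primrec.unpair)) (Primrec.const [])))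
  have hid : Nat.RecursiveIn {oracle X} (fun n : ℕ => Part.some n) :=
    (Nat.Primrec.id).recursiveIn
  have hseg : Nat.RecursiveIn {oracle X}
      (fun q => Part.some (Encodable.encode (initSeg X q.unpair.2))) :=
    Nat.RecursiveIn.of_eq (Nat.RecursiveIn.comp (recursiveIn_initSeg X) .right) (by intro n; simp)
  have hg := Nat.RecursiveIn.comp hf.recursiveIn (Nat.RecursiveIn.pair hid hseg)
  have hr := Nat.RecursiveIn.rfind hg
  have hz : Nat.RecursiveIn {oracle X} (fun _ : ℕ => Part.some 0) :=
    (Nat.Primrec.const 0).recursiveIn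
  refine ⟨_, Nat.RecursiveIn.comp hz hr, ?_, ?_⟩
  · ext x
    simp only [PFun.Dom, Seq.seq, f, Part.bind_eq_bind, Part.map_eq_map, Part.map_some,
      Part.bind_some, Nat.unpair_pair, Part.coe_some, Encodable.encodek, Option.getD_some]
    simp only [Set.mem_ofPred_eq, Part.bind_dom, Part.some_dom, exists_prop, and_true]
    rw [@Nat.rfind_dom (fun s => Part.some (decide ((if R x s (initSeg X s) then 0 else 1) = 0)))]
    simp
  · intro x v hv
    simp at hv
    exact hv.2

/-! ### The construction -/

/-- `x` lies in the `m`-th dyadic block `[2 ^ m, 2 ^ (m + 1))`. -/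
def InBlock (m x : ℕ) : Prop :=
  2 ^ m ≤ x ∧ x < 2 ^ (m + 1)

/-- The initial segment of length `m` of the stage `s` approximation. -/
def approxSeg (a : ℕ → ℕ → Bool) (s m : ℕ) : List Bool :=
  (List.range m).map (a s)

/-- No element of the block `m` with residue `j` modulo `2 ^ p` has been enumerated in `W`. -/
def Missed (W : ℕ → ℕ → Prop) (p m s j : ℕ) : Prop :=
  ∀ x < 2 ^ (m + 1), InBlock m x → x % 2 ^ p = j → ¬ W s x

open Classical in
/-- The residues modulo `2 ^ p` that are missed by `W` in the block `m` at stage `s`. -/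
noncomputable def missedList (W : ℕ → ℕ → Prop) (p m s : ℕ) : List ℕ :=
  (List.range (2 ^ p)).filter fun j => Missed W p m s j

/-- `W` has responded in the block `m`: it meets at least half of the residue classes. -/
def Responded (W : ℕ → ℕ → Prop) (p m s : ℕ) : Prop :=
  -- Half is the right threshold: doubling the surviving classes gives back at most `2 ^ p` strings.
  2 * (missedList W p m s).length ≤ 2 ^ p

/-- `x` was enumerated in `W` by the time `W` responded in the block `m`. -/
def Frozen (W : ℕ → ℕ → Prop) (p m s x : ℕ) : Prop :=
  -- For monotone `W` only the first response matters. Before any response this is vacuous, which is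
  -- why `Chosen` also asks for `Responded`.
  ∀ u < s + 1, Responded W p m u → W u x

/-- The residue class `j` contains a frozen element of the block `m`. -/
def Hit (W : ℕ → ℕ → Prop) (p m s j : ℕ) : Prop :=
  ∃ x < 2 ^ (m + 1), InBlock m x ∧ x % 2 ^ p = j ∧ Frozen W p m s x

/-- According to the stage `s` approximation `a`, the response of `W` in the block `m` came before
the first stage that approximates the first `m` bits correctly. -/
def Permitted (a : ℕ → ℕ → Bool) (W : ℕ → ℕ → Prop) (p m s : ℕ) : Prop :=
  ∀ t < s + 1, m ≤ t → approxSeg a t m = approxSeg a s m → Responded W p m t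

open Classical in
/-- The one-bit extensions of those strings in `L` whose residue class is not hit. -/
noncomputable def children (W : ℕ → ℕ → Prop) (p m s : ℕ) (L : List (List Bool)) :
    List (List Bool) :=
  (List.range L.length).flatMap fun j =>
    if Hit W p m s j then [] else [L.getD j [] ++ [false], L.getD j [] ++ [true]]

open Classical in
/-- The scan, at stage `s`, of the blocks `0, …, k - 1` with records `r`. Its result consists of
the current node, the list of strings at this node, and whether a block of this node is still
waiting for a response. -/
noncomputable def scan (a : ℕ → ℕ → Bool) (W : ℕ → ℕ → Prop) (p : ℕ)
    (r : ℕ → Option (ℕ × List (List Bool))) (s : ℕ) : ℕ → ℕ × List (List Bool) × Bool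
  -- The root is node `0`; any other node is named by the successor of the block whose permission
  -- created it.
  | 0 => (0, [[]], false)
  | k + 1 =>
    if r k = some ((scan a W p r s k).1, (scan a W p r s k).2.1) then
      if Permitted a W p k s then (k + 1, children W p k s (scan a W p r s k).2.1, false)
      else if Responded W p k s then scan a W p r s k
      -- The flag raised here is lowered only by a move to a new node.
      else ((scan a W p r s k).1, (scan a W p r s k).2.1, true)
    else scan a W p r s k

open Classical in
/-- The record of the block `n`, given the records of the earlier blocks. -/
noncomputable def nextRecord (a : ℕ → ℕ → Bool) (W : ℕ → ℕ → Prop) (p n : ℕ)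
    (r : ℕ → Option (ℕ × List (List Bool))) : Option (ℕ × List (List Bool)) :=
  -- Here `n` is both block and stage. The bound `2 * p ≤ n` serves the frequency estimates: the `2
  -- ^ p` residues fit into the block `n - p`.
  if 2 * p ≤ n ∧ (scan a W p r n n).2.2 = false then
    some ((scan a W p r n n).1, (scan a W p r n n).2.1) else none

/-- The list of the records of the blocks `0, …, n - 1`. -/
noncomputable def history (a : ℕ → ℕ → Bool) (W : ℕ → ℕ → Prop) (p : ℕ) :
    ℕ → List (Option (ℕ × List (List Bool)))
  | 0 => []
  | n + 1 => history a W p n ++ [nextRecord a W p n fun k => (history a W p n).getD k none]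

/-- The record of the block `n`: the node and the list of strings that it is assigned to. -/
noncomputable def record (a : ℕ → ℕ → Bool) (W : ℕ → ℕ → Prop) (p n : ℕ) :
    Option (ℕ × List (List Bool)) :=
  (history a W p (n + 1)).getD n none

/-! ### The recursion satisfied by the records -/

theorem length_history (a : ℕ → ℕ → Bool) (W : ℕ → ℕ → Prop) (p n : ℕ) :
    (history a W p n).length = n := by
  induction n with
  | zero => rfl
  | succ n ih => simp [history, ih]

theorem getD_history (a : ℕ → ℕ → Bool) (W : ℕ → ℕ → Prop) (p : ℕ) {n k : ℕ} (h : k < n) :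
    (history a W p n).getD k none = record a W p k := by
  induction n with
  | zero => omega
  | succ n ih =>
    rcases Nat.lt_succ_iff_lt_or_eq.1 h with h | rfl
    · rw [← ih h, history, List.getD_append _ _ _ _ (by rwa [length_history])]
    · rfl

theorem scan_congr (a : ℕ → ℕ → Bool) (W : ℕ → ℕ → Prop) (p s : ℕ)
    {r r' : ℕ → Option (ℕ × List (List Bool))} {k : ℕ} (h : ∀ i < k, r i = r' i) :
    scan a W p r s k = scan a W p r' s k := by
  induction k with
  | zero => rfl
  | succ k ih =>
    rw [scan, scan, ih fun i hi => h i (by omega), h k (by omega)]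

/-- The scan of the first `n` blocks reads only earlier records, so the truncated history may be
replaced by the whole sequence. -/
theorem record_eq (a : ℕ → ℕ → Bool) (W : ℕ → ℕ → Prop) (p n : ℕ) :
    record a W p n = nextRecord a W p n (record a W p) := by
  have h : record a W p n = nextRecord a W p n fun k => (history a W p n).getD k none := by
    rw [record, history, List.getD_append_right _ _ _ _ (by rw [length_history])]
    simp [length_history]
  rw [h, nextRecord, nextRecord, scan_congr a W p n fun i hi => getD_history a W p hi]

/-! ### Primitive recursiveness of the construction -/

section Primrec

variable {α : Type*} [Primcodable α] {a : ℕ → ℕ → Bool} {W : ℕ → ℕ → ℕ → Prop} {p m s x : α → ℕ}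

theorem primrecPred_inBlock (hm : Primrec m) (hx : Primrec x) :
    PrimrecPred fun c => InBlock (m c) (x c) :=
  (PrimrecRel.comp Primrec.nat_le (primrec_pow.comp (Primrec.const 2) hm) hx).and
    (PrimrecRel.comp Primrec.nat_lt hx
      (primrec_pow.comp (Primrec.const 2) (Primrec.succ.comp hm)))

theorem primrec_approxSeg (ha : Primrec₂ a) (hs : Primrec s) (hm : Primrec m) :
    Primrec fun c => approxSeg a (s c) (m c) :=
  Primrec.list_map (Primrec.list_range.comp hm) (ha.comp (hs.comp Primrec.fst) Primrec.snd)

theorem primrecPred_comp₃ (hW : PrimrecPred fun q : ℕ × ℕ × ℕ => W q.1 q.2.1 q.2.2)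
    (hp : Primrec p) (hs : Primrec s) (hx : Primrec x) :
    PrimrecPred fun c => W (p c) (s c) (x c) :=
  hW.comp (f := fun c => (p c, s c, x c)) (hp.pair (hs.pair hx))

theorem primrecPred_missed (hW : PrimrecPred fun q : ℕ × ℕ × ℕ => W q.1 q.2.1 q.2.2)
    (hp : Primrec p) (hm : Primrec m) (hs : Primrec s) (hx : Primrec x) :
    PrimrecPred fun c => Missed (W (p c)) (p c) (m c) (s c) (x c) := by
  refine primrecPred_ball_lt (R := fun c y => InBlock (m c) y → y % 2 ^ p c = x c →
    ¬ W (p c) (s c) y) (primrec_pow.comp (Primrec.const 2) (Primrec.succ.comp hm)) ?_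
  refine primrecPred_imp (primrecPred_inBlock (hm.comp Primrec.fst) Primrec.snd)
    (primrecPred_imp (PrimrecRel.comp Primrec.eq ?_ (hx.comp Primrec.fst)) (PrimrecPred.not ?_))
  · exact Primrec.nat_mod.comp Primrec.snd
      (primrec_pow.comp (Primrec.const 2) (hp.comp Primrec.fst))
  · exact primrecPred_comp₃ hW (hp.comp Primrec.fst) (hs.comp Primrec.fst) Primrec.snd

theorem primrecPred_responded (hW : PrimrecPred fun q : ℕ × ℕ × ℕ => W q.1 q.2.1 q.2.2)
    (hp : Primrec p) (hm : Primrec m) (hs : Primrec s) :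
    PrimrecPred fun c => Responded (W (p c)) (p c) (m c) (s c) := by
  classical
  have hpow : Primrec fun c => 2 ^ p c := primrec_pow.comp (Primrec.const 2) hp
  have hR : PrimrecRel fun (j : ℕ) (c : α) => Missed (W (p c)) (p c) (m c) (s c) j :=
    primrecPred_missed hW (hp.comp Primrec.snd) (hm.comp Primrec.snd) (hs.comp Primrec.snd)
      Primrec.fst
  have hl : Primrec fun c => missedList (W (p c)) (p c) (m c) (s c) :=
    hR.listFilter.comp (Primrec.list_range.comp hpow) Primrec.id
  exact PrimrecRel.comp Primrec.nat_le
    (Primrec.nat_mul.comp (Primrec.const 2) (Primrec.list_length.comp hl)) hpow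

theorem primrecPred_frozen (hW : PrimrecPred fun q : ℕ × ℕ × ℕ => W q.1 q.2.1 q.2.2)
    (hp : Primrec p) (hm : Primrec m) (hs : Primrec s) (hx : Primrec x) :
    PrimrecPred fun c => Frozen (W (p c)) (p c) (m c) (s c) (x c) := by
  refine primrecPred_ball_lt (R := fun c u => Responded (W (p c)) (p c) (m c) u →
    W (p c) u (x c)) (Primrec.succ.comp hs) (primrecPred_imp ?_ ?_)
  · exact primrecPred_responded hW (hp.comp Primrec.fst) (hm.comp Primrec.fst) Primrec.snd
  · exact primrecPred_comp₃ hW (hp.comp Primrec.fst) Primrec.snd (hx.comp Primrec.fst)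

theorem primrecPred_hit (hW : PrimrecPred fun q : ℕ × ℕ × ℕ => W q.1 q.2.1 q.2.2)
    (hp : Primrec p) (hm : Primrec m) (hs : Primrec s) (hx : Primrec x) :
    PrimrecPred fun c => Hit (W (p c)) (p c) (m c) (s c) (x c) := by
  refine primrecPred_bex_lt (R := fun c y => InBlock (m c) y ∧ y % 2 ^ p c = x c ∧
    Frozen (W (p c)) (p c) (m c) (s c) y)
    (primrec_pow.comp (Primrec.const 2) (Primrec.succ.comp hm)) ?_
  refine (primrecPred_inBlock (hm.comp Primrec.fst) Primrec.snd).and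
    ((PrimrecRel.comp Primrec.eq ?_ (hx.comp Primrec.fst)).and ?_)
  · exact Primrec.nat_mod.comp Primrec.snd
      (primrec_pow.comp (Primrec.const 2) (hp.comp Primrec.fst))
  · exact primrecPred_frozen hW (hp.comp Primrec.fst) (hm.comp Primrec.fst)
      (hs.comp Primrec.fst) Primrec.snd

theorem primrecPred_permitted (ha : Primrec₂ a)
    (hW : PrimrecPred fun q : ℕ × ℕ × ℕ => W q.1 q.2.1 q.2.2)
    (hp : Primrec p) (hm : Primrec m) (hs : Primrec s) :
    PrimrecPred fun c => Permitted a (W (p c)) (p c) (m c) (s c) := by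
  refine primrecPred_ball_lt (R := fun c t => m c ≤ t →
    approxSeg a t (m c) = approxSeg a (s c) (m c) → Responded (W (p c)) (p c) (m c) t)
    (Primrec.succ.comp hs) ?_
  refine primrecPred_imp (PrimrecRel.comp Primrec.nat_le (hm.comp Primrec.fst) Primrec.snd)
    (primrecPred_imp (PrimrecRel.comp Primrec.eq ?_ ?_) ?_)
  · exact primrec_approxSeg ha Primrec.snd (hm.comp Primrec.fst)
  · exact primrec_approxSeg ha (hs.comp Primrec.fst) (hm.comp Primrec.fst)
  · exact primrecPred_responded hW (hp.comp Primrec.fst) (hm.comp Primrec.fst) Primrec.snd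

theorem primrec_children (hW : PrimrecPred fun q : ℕ × ℕ × ℕ => W q.1 q.2.1 q.2.2)
    {L : α → List (List Bool)} (hp : Primrec p) (hm : Primrec m) (hs : Primrec s)
    (hL : Primrec L) : Primrec fun c => children (W (p c)) (p c) (m c) (s c) (L c) := by
  classical
  have hσ : Primrec fun q : α × ℕ => (L q.1).getD q.2 [] :=
    (Primrec.list_getD []).comp (hL.comp Primrec.fst) Primrec.snd
  refine Primrec.list_flatMap (Primrec.list_range.comp (Primrec.list_length.comp hL))
    (g := fun c j => if Hit (W (p c)) (p c) (m c) (s c) j then []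
      else [(L c).getD j [] ++ [false], (L c).getD j [] ++ [true]]) ?_
  refine Primrec.ite ?_ (Primrec.const []) ?_
  · exact primrecPred_hit hW (hp.comp Primrec.fst) (hm.comp Primrec.fst) (hs.comp Primrec.fst)
      Primrec.snd
  · exact Primrec.list_cons.comp (Primrec.list_concat.comp hσ (Primrec.const false))
      (Primrec.list_cons.comp (Primrec.list_concat.comp hσ (Primrec.const true))
        (Primrec.const []))

theorem primrec_scan (ha : Primrec₂ a)
    (hW : PrimrecPred fun q : ℕ × ℕ × ℕ => W q.1 q.2.1 q.2.2)
    {H : α → List (Option (ℕ × List (List Bool)))} {k : α → ℕ} (hp : Primrec p)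
    (hH : Primrec H) (hs : Primrec s) (hk : Primrec k) :
    Primrec fun c => scan a (W (p c)) (p c) (fun i => (H c).getD i none) (s c) (k c) := by
  classical
  let g : α → ℕ × (ℕ × List (List Bool) × Bool) → ℕ × List (List Bool) × Bool := fun c q =>
    if (H c).getD q.1 none = some (q.2.1, q.2.2.1) then
      if Permitted a (W (p c)) (p c) q.1 (s c) then
        (q.1 + 1, children (W (p c)) (p c) q.1 (s c) q.2.2.1, false)
      else if Responded (W (p c)) (p c) q.1 (s c) then q.2 else (q.2.1, q.2.2.1, true)
    else q.2
  have hg : Primrec₂ g := by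
    have h1 : Primrec fun q : α × ℕ × ℕ × List (List Bool) × Bool => q.2.1 :=
      Primrec.fst.comp Primrec.snd
    have h2 : Primrec fun q : α × ℕ × ℕ × List (List Bool) × Bool => q.2.2 :=
      Primrec.snd.comp Primrec.snd
    have h3 : Primrec fun q : α × ℕ × ℕ × List (List Bool) × Bool => q.2.2.1 :=
      Primrec.fst.comp h2
    have h4 : Primrec fun q : α × ℕ × ℕ × List (List Bool) × Bool => q.2.2.2.1 :=
      Primrec.fst.comp (Primrec.snd.comp h2)
    refine Primrec.ite (PrimrecRel.comp Primrec.eq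
      ((Primrec.list_getD none).comp (hH.comp Primrec.fst) h1)
      (Primrec.option_some.comp (h3.pair h4))) (Primrec.ite ?_ ?_ (Primrec.ite ?_ h2 ?_)) h2
    · exact primrecPred_permitted ha hW (hp.comp Primrec.fst) h1 (hs.comp Primrec.fst)
    · exact (Primrec.succ.comp h1).pair (Primrec.pair
        (primrec_children hW (hp.comp Primrec.fst) h1 (hs.comp Primrec.fst) h4)
        (Primrec.const false))
    · exact primrecPred_responded hW (hp.comp Primrec.fst) h1 (hs.comp Primrec.fst)
    · exact h3.pair (h4.pair (Primrec.const true))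
  refine (Primrec.nat_rec' hk (Primrec.const (0, [[]], false)) hg).of_eq fun c => ?_
  induction k c with
  | zero => rfl
  | succ k ih =>
    rw [scan, ← ih]

theorem primrec_history (ha : Primrec₂ a)
    (hW : PrimrecPred fun q : ℕ × ℕ × ℕ => W q.1 q.2.1 q.2.2) {n : α → ℕ}
    (hp : Primrec p) (hn : Primrec n) :
    Primrec fun c => history a (W (p c)) (p c) (n c) := by
  classical
  let g : α → ℕ × List (Option (ℕ × List (List Bool))) → List (Option (ℕ × List (List Bool))) :=
    fun c q => q.2 ++ [nextRecord a (W (p c)) (p c) q.1 fun k => q.2.getD k none]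
  have hg : Primrec₂ g := by
    have h1 : Primrec fun q : α × ℕ × List (Option (ℕ × List (List Bool))) => q.2.1 :=
      Primrec.fst.comp Primrec.snd
    have h2 : Primrec fun q : α × ℕ × List (Option (ℕ × List (List Bool))) => q.2.2 :=
      Primrec.snd.comp Primrec.snd
    have h3 := primrec_scan ha hW (hp.comp Primrec.fst) h2 h1 h1
    refine Primrec.list_concat.comp h2 (Primrec.ite (PrimrecPred.and ?_ ?_) ?_ (Primrec.const _))
    · exact PrimrecRel.comp Primrec.nat_le
        (Primrec.nat_mul.comp (Primrec.const 2) (hp.comp Primrec.fst)) h1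
    · exact PrimrecRel.comp Primrec.eq (Primrec.snd.comp (Primrec.snd.comp h3))
        (Primrec.const false)
    · exact Primrec.option_some.comp
        ((Primrec.fst.comp h3).pair (Primrec.fst.comp (Primrec.snd.comp h3)))
  refine (Primrec.nat_rec' hn (Primrec.const []) hg).of_eq fun c => ?_
  induction n c with
  | zero => rfl
  | succ n ih => rw [history, ← ih]

/-- Uniformity in `p` matters because a single oracle computation serves all requirements. -/
theorem primrec_record (ha : Primrec₂ a)
    (hW : PrimrecPred fun q : ℕ × ℕ × ℕ => W q.1 q.2.1 q.2.2) {n : α → ℕ}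
    (hp : Primrec p) (hn : Primrec n) :
    Primrec fun c => record a (W (p c)) (p c) (n c) :=
  (Primrec.list_getD none).comp (primrec_history ha hW hp (Primrec.succ.comp hn)) hn

theorem primrec_scan_record (ha : Primrec₂ a)
    (hW : PrimrecPred fun q : ℕ × ℕ × ℕ => W q.1 q.2.1 q.2.2) {k : α → ℕ}
    (hp : Primrec p) (hs : Primrec s) (hk : Primrec k) :
    Primrec fun c => scan a (W (p c)) (p c) (record a (W (p c)) (p c)) (s c) (k c) :=
  (primrec_scan ha hW hp (primrec_history ha hW hp hk) hs hk).of_eq fun _ =>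
    scan_congr _ _ _ _ fun _ hi => getD_history a _ _ hi

end Primrec

/-! ### Isolated sequences -/

theorem initSeg_prefix (X : Set ℕ) {m n : ℕ} (h : m ≤ n) : initSeg X m <+: initSeg X n := by
  rw [← take_initSeg X h]
  exact List.take_prefix _ _

theorem eq_initSeg_of_prefix {X : Set ℕ} {n : ℕ} {σ : List Bool} (h : σ <+: initSeg X n) :
    σ = initSeg X σ.length := by
  have h1 := List.prefix_iff_eq_take.1 h
  have h2 := h.length_le
  rw [length_initSeg] at h2
  rwa [take_initSeg X h2] at h1

theorem countP_lt_countP_of_imp {α : Type*} {l : List α} {q r : α → Bool}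
    (h : ∀ x ∈ l, q x = true → r x = true) {x : α} (hx : x ∈ l) (hr : r x = true)
    (hq : q x = false) : l.countP q < l.countP r := by
  induction l with
  | nil => simp at hx
  | cons y l ih =>
    have hle : l.countP q ≤ l.countP r :=
      List.countP_mono_left fun z hz => h z (List.mem_cons_of_mem _ hz)
    rcases List.mem_cons.1 hx with rfl | hx
    · simp only [List.countP_cons, hr, hq]
      simp
      omega
    · have := ih (fun z hz => h z (List.mem_cons_of_mem _ hz)) hx
      have hy := h y List.mem_cons_self
      simp only [List.countP_cons]
      by_cases h1 : q y = true
      · simp [h1, hy h1, this]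
      · simp only [h1]
        simp
        omega

/-- A path through levels of bounded width is eventually determined by one of its initial
segments. -/
theorem exists_isolating_initSeg {X : Set ℕ} {L : ℕ → List (List Bool)} {M : ℕ}
    (hM : ∀ i, (L i).length ≤ M) :
    ∃ c, ∀ n, ∃ i ≥ c, ∀ σ ∈ L i, initSeg X c <+: σ →
      ∃ b, σ[n]? = some b ∧ (b = true ↔ n ∈ X) := by
  classical
  let cnt : ℕ → ℕ → ℕ := fun c i => (L i).countP fun σ => decide (initSeg X c <+: σ)
  -- Minimise the number `r` of strings extending `initSeg X c`, attained at infinitely many levels,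
  -- over all `c`.
  have hex : ∃ r c, ∃ᶠ i in atTop, cnt c i ≤ r :=
    ⟨M, 0, Frequently.of_forall fun i => List.countP_le_length.trans (hM i)⟩
  obtain ⟨c, hc⟩ := Nat.find_spec hex
  have hmin := fun r (h : r < Nat.find hex) => Nat.find_min hex h
  generalize Nat.find hex = r at hc hmin
  refine ⟨c, fun n => ?_⟩
  by_contra hcon
  push Not at hcon
  -- If `n` were bad, each later level would have a string extending `initSeg X c` but not the
  -- longer segment, contradicting minimality.
  have hlt : ∀ i ≥ max c (n + 1), cnt (max c (n + 1)) i < cnt c i := by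
    intro i hi
    obtain ⟨σ, hσ, hcσ, hb⟩ := hcon i (le_trans (le_max_left _ _) hi)
    refine countP_lt_countP_of_imp ?_ hσ (by simpa using hcσ) ?_
    · intro ρ _ hρ
      simp only [decide_eq_true_eq] at hρ ⊢
      exact (initSeg_prefix X (le_max_left _ _)).trans hρ
    · simp only [decide_eq_false_iff_not]
      intro hpre
      obtain ⟨b, hb1, hb2⟩ := getElem?_initSeg (X := X) (lt_of_lt_of_le n.lt_succ_self
        (le_max_right c (n + 1)))
      have h3 : σ[n]? = some b := by
        obtain ⟨t, rfl⟩ := hpre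
        rw [List.getElem?_append_left (by rw [length_initSeg]; omega), hb1]
      rcases hb b h3 with ⟨h4, h5⟩ | ⟨h4, h5⟩
      · exact h5 (hb2.1 h4)
      · exact h4 (hb2.2 h5)
  have hfr : ∃ᶠ i in atTop, cnt (max c (n + 1)) i ≤ r - 1 ∧ 1 ≤ r := by
    refine (hc.and_eventually (eventually_ge_atTop (max c (n + 1)))).mono ?_
    rintro i ⟨h1, h2⟩
    have := hlt i h2
    omega
  obtain ⟨i, -, hr⟩ := hfr.exists
  exact hmin (r - 1) (by omega) ⟨_, hfr.mono fun i h => h.1⟩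

/-! ### The scan -/

section Scan

variable (a : ℕ → ℕ → Bool) (W : ℕ → ℕ → Prop) (p : ℕ)

theorem scan_fst_le (r : ℕ → Option (ℕ × List (List Bool))) (s k : ℕ) :
    (scan a W p r s k).1 ≤ k := by
  induction k with
  | zero => simp [scan]
  | succ k ih =>
    rw [scan]
    split_ifs
    · exact le_rfl
    all_goals exact ih.trans (Nat.le_succ k)

variable {a W p}

theorem mem_children {m s : ℕ} {L : List (List Bool)} {τ : List Bool} :
    τ ∈ children W p m s L ↔
      ∃ (j : ℕ) (σ : List Bool) (b : Bool), L[j]? = some σ ∧ ¬ Hit W p m s j ∧ τ = σ ++ [b] := by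
  classical
  simp only [children, List.mem_flatMap, List.mem_range]
  constructor
  · rintro ⟨j, hj, h⟩
    split_ifs at h with hh
    · simp at h
    · refine ⟨j, L[j], ?_⟩
      simp only [List.getD_eq_getElem?_getD, List.getElem?_eq_getElem hj, Option.getD_some,
        List.mem_cons, List.not_mem_nil, or_false] at h
      rcases h with rfl | rfl
      · exact ⟨false, by simp, hh, rfl⟩
      · exact ⟨true, by simp, hh, rfl⟩
  · rintro ⟨j, σ, b, hj, hh, rfl⟩
    have hj' : j < L.length := by
      by_contra h
      rw [List.getElem?_eq_none (by omega)] at hj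
      simp at hj
    refine ⟨j, hj', ?_⟩
    rw [if_neg hh]
    simp only [List.getD_eq_getElem?_getD, hj, Option.getD_some]
    cases b <;> simp

/-- A scan only ever replaces a list by one-bit extensions of some of its strings. -/
theorem scan_prefix (r : ℕ → Option (ℕ × List (List Bool))) (s : ℕ) {k k' : ℕ} (h : k ≤ k') :
    ∀ σ ∈ (scan a W p r s k').2.1, ∃ ρ ∈ (scan a W p r s k).2.1, ρ <+: σ := by
  induction k', h using Nat.le_induction with
  | base => exact fun σ hσ => ⟨σ, hσ, List.prefix_refl σ⟩
  | succ k' _ ih =>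
    intro σ hσ
    rw [scan] at hσ
    split_ifs at hσ
    · obtain ⟨j, ρ, b, hj, -, rfl⟩ := mem_children.1 hσ
      obtain ⟨π, hπ, hπρ⟩ := ih ρ (List.mem_of_getElem? hj)
      exact ⟨π, hπ, hπρ.trans (List.prefix_append _ _)⟩
    all_goals exact ih σ hσ

/-- Passing an unresponsive block of the current node raises the flag until the node changes, so a
lowered flag certifies all responses. -/
theorem responded_of_scan_eq (r : ℕ → Option (ℕ × List (List Bool))) (s k : ℕ) {v : ℕ}
    {L : List (List Bool)} {b : Bool} (h : scan a W p r s k = (v, L, b)) :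
    b = false → ∀ m, v ≤ m → m < k → r m = some (v, L) → Responded W p m s := by
  induction k generalizing v L b with
  | zero => intro _ m _ hm; omega
  | succ k ih =>
    intro hb m hvm hmk hr
    rw [scan] at h
    split_ifs at h with h1 h2 h3
    · simp only [Prod.mk.injEq] at h
      omega
    · rcases Nat.lt_succ_iff_lt_or_eq.1 hmk with hmk | rfl
      · exact ih h hb m hvm hmk hr
      · exact h3
    · simp only [Prod.mk.injEq] at h
      rw [← h.2.2] at hb
      simp at hb
    · rcases Nat.lt_succ_iff_lt_or_eq.1 hmk with hmk | rfl
      · exact ih h hb m hvm hmk hr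
      · exact absurd (by rw [h]; exact hr) h1

theorem record_eq_some {n v : ℕ} {L : List (List Bool)} (h : record a W p n = some (v, L)) :
    2 * p ≤ n ∧ scan a W p (record a W p) n n = (v, L, false) := by
  rw [record_eq, nextRecord] at h
  split_ifs at h with hc
  simp only [Option.some.injEq, Prod.mk.injEq] at h
  exact ⟨hc.1, by rw [← h.1, ← h.2, ← hc.2]⟩

theorem record_eq_some_le {n v : ℕ} {L : List (List Bool)}
    (h : record a W p n = some (v, L)) : v ≤ n := by
  have h1 := scan_fst_le a W p (record a W p) n n
  rwa [(record_eq_some h).2] at h1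

theorem responded_of_record {m m' v : ℕ} {L : List (List Bool)} (hm : m < m')
    (h : record a W p m = some (v, L)) (h' : record a W p m' = some (v, L)) :
    Responded W p m m' :=
  responded_of_scan_eq _ _ _ (record_eq_some h').2 rfl m (record_eq_some_le h) hm h

/-- As long as no block of the current node is permitted, the scan stays at the node. -/
theorem scan_stay (r : ℕ → Option (ℕ × List (List Bool))) {s v k : ℕ} {L : List (List Bool)}
    {b : Bool} (h0 : scan a W p r s v = (v, L, b)) (hvk : v ≤ k)
    (h : ∀ m < k, r m = some (v, L) → ¬ Permitted a W p m s) :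
    (scan a W p r s k).1 = v ∧ (scan a W p r s k).2.1 = L ∧
      ((∀ m < k, r m = some (v, L) → Responded W p m s) → (scan a W p r s k).2.2 = b) := by
  induction k, hvk using Nat.le_induction with
  | base => simp [h0]
  | succ k _ ih =>
    obtain ⟨h1, h2, h3⟩ := ih fun m hm => h m (by omega)
    rw [scan]
    split_ifs with g1 g2 g3
    · rw [h1, h2] at g1
      exact absurd g2 (h k (by omega) g1)
    · exact ⟨h1, h2, fun hr => h3 fun m hm => hr m (by omega)⟩
    · rw [h1, h2] at g1
      exact ⟨h1, h2, fun hr => absurd (hr k (by omega) g1) g3⟩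
    · exact ⟨h1, h2, fun hr => h3 fun m hm => hr m (by omega)⟩

end Scan

/-! ### Monotonicity in the stage -/

section Mono

variable {W : ℕ → ℕ → Prop} {p m : ℕ} (hW : ∀ x s t, s ≤ t → W s x → W t x)
include hW

theorem Missed.anti {s t j : ℕ} (hst : s ≤ t) (h : Missed W p m t j) : Missed W p m s j :=
  fun x hx hb hj hs => h x hx hb hj (hW x s t hst hs)

theorem Responded.mono {s t : ℕ} (hst : s ≤ t) (h : Responded W p m s) : Responded W p m t := by
  classical
  refine le_trans (Nat.mul_le_mul_left 2 (List.Sublist.length_le ?_)) h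
  refine List.monotone_filter_right _ fun j hj => ?_
  simp only [decide_eq_true_eq] at hj ⊢
  exact hj.anti hW hst

theorem frozen_iff {s g x : ℕ} (hg : Responded W p m g) (hgs : g ≤ s)
    (hmin : ∀ u < g, ¬ Responded W p m u) : Frozen W p m s x ↔ W g x := by
  constructor
  · exact fun h => h g (by omega) hg
  · intro h u _ hu
    exact hW x g u (not_lt.1 fun hlt => hmin u hlt hu) h

/-- All stages after the response see the same frozen part, namely `W` at the first response. -/
theorem exists_first_response {s : ℕ} (h : Responded W p m s) :
    ∃ g ≤ s, Responded W p m g ∧ ∀ t, Responded W p m t → ∀ x, Frozen W p m t x ↔ W g x := by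
  classical
  have hex : ∃ g, Responded W p m g := ⟨s, h⟩
  refine ⟨Nat.find hex, Nat.find_min' hex h, Nat.find_spec hex, fun t ht x => ?_⟩
  exact frozen_iff hW (Nat.find_spec hex) (Nat.find_min' hex ht) fun u hu => Nat.find_min hex hu

theorem frozen_congr {s t x : ℕ} (hs : Responded W p m s) (ht : Responded W p m t) :
    Frozen W p m s x ↔ Frozen W p m t x := by
  obtain ⟨g, -, -, h⟩ := exists_first_response hW hs
  rw [h s hs, h t ht]

/-- Hits depend only on the frozen part, so the list of a new node does not change with the stage.
-/
theorem children_congr {s t : ℕ} (hs : Responded W p m s) (ht : Responded W p m t)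
    (L : List (List Bool)) : children W p m s L = children W p m t L := by
  have : ∀ j, Hit W p m s j ↔ Hit W p m t j := fun j => by
    simp only [Hit, frozen_congr hW hs ht]
  classical
  rw [children, children]
  congr 1
  funext j
  exact if_congr (this j) rfl rfl

/-- A class that is not hit was missed at the first response, so at most half of the classes
survive, and each surviving string has two extensions. -/
theorem length_children_le {s : ℕ} {L : List (List Bool)} (hs : Responded W p m s)
    (hL : L.length ≤ 2 ^ p) : (children W p m s L).length ≤ 2 ^ p := by
  classical
  obtain ⟨g, -, hg, hfr⟩ := exists_first_response hW hs
  have h1 : ∀ l : List ℕ, (l.flatMap fun j => if Hit W p m s j then [] else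
      [L.getD j [] ++ [false], L.getD j [] ++ [true]]).length =
      2 * (l.filter fun j => ¬ Hit W p m s j).length := by
    intro l
    induction l with
    | nil => rfl
    | cons j l ih =>
      rw [List.flatMap_cons, List.length_append, ih]
      by_cases hj : Hit W p m s j <;> (simp [hj]; try omega)
  rw [children, h1]
  refine le_trans (Nat.mul_le_mul_left 2 ?_) hg
  calc ((List.range L.length).filter fun j => ¬ Hit W p m s j).length
      ≤ ((List.range L.length).filter fun j => Missed W p m g j).length := by
        refine List.Sublist.length_le (List.monotone_filter_right _ fun j hj => ?_)
        simp only [decide_eq_true_eq] at hj ⊢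
        intro x hx hb hxj hgx
        exact hj ⟨x, hx, hb, hxj, (hfr s hs x).2 hgx⟩
    _ ≤ (missedList W p m g).length :=
        List.Sublist.length_le (List.Sublist.filter _ (List.range_sublist.2 hL))

end Mono

/-! ### Stable nodes -/

/-- `v` is a node on the true path of the construction, with list of strings `L`. -/
def IsStableNode (a : ℕ → ℕ → Bool) (W : ℕ → ℕ → Prop) (p v : ℕ) (L : List (List Bool)) : Prop :=
  ∀ᶠ s in atTop, scan a W p (record a W p) s v = (v, L, false)

/-- The response of `W` in the block `m` comes before the first stage from `m` on at which the
first `m` bits of `A` are approximated correctly. -/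
def TrulyPermitted (A : Set ℕ) (a : ℕ → ℕ → Bool) (W : ℕ → ℕ → Prop) (p m : ℕ) : Prop :=
  ∀ t ≥ m, approxSeg a t m = initSeg A m → Responded W p m t

theorem approxSeg_eq_initSeg {A : Set ℕ} {a : ℕ → ℕ → Bool} {s m : ℕ} :
    approxSeg a s m = initSeg A m ↔ ∀ i < m, (a s i = true ↔ i ∈ A) := by
  classical
  rw [approxSeg, initSeg, List.map_inj_left]
  simp only [List.mem_range]
  refine forall₂_congr fun i _ => ?_
  by_cases h : i ∈ A <;> simp [h]

theorem eventually_approxSeg {A : Set ℕ} {a : ℕ → ℕ → Bool}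
    (ha : ∀ n, ∀ᶠ s in atTop, (a s n = true ↔ n ∈ A)) (m : ℕ) :
    ∀ᶠ s in atTop, approxSeg a s m = initSeg A m := by
  have : ∀ᶠ s in atTop, ∀ i ∈ Finset.range m, (a s i = true ↔ i ∈ A) := by
    rw [Filter.eventually_all_finset]
    exact fun i _ => ha i
  filter_upwards [this] with s hs
  exact approxSeg_eq_initSeg.2 fun i hi => hs i (Finset.mem_range.2 hi)

section Limit

variable {A : Set ℕ} {a : ℕ → ℕ → Bool} {W : ℕ → ℕ → Prop} {p : ℕ}

/-- Once the first `m` bits have settled, permission quantifies over correct stages only. -/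
theorem TrulyPermitted.eventually {m : ℕ}
    (ha : ∀ n, ∀ᶠ s in atTop, (a s n = true ↔ n ∈ A)) (h : TrulyPermitted A a W p m) :
    ∀ᶠ s in atTop, Permitted a W p m s := by
  filter_upwards [eventually_approxSeg ha m] with s hs t _ hmt heq
  exact h t hmt (heq.trans hs)

theorem eventually_not_permitted {m : ℕ}
    (ha : ∀ n, ∀ᶠ s in atTop, (a s n = true ↔ n ∈ A)) (h : ¬ TrulyPermitted A a W p m) :
    ∀ᶠ s in atTop, ¬ Permitted a W p m s := by
  simp only [TrulyPermitted, not_forall] at h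
  obtain ⟨t, hmt, heq, hr⟩ := h
  filter_upwards [eventually_approxSeg ha m, eventually_ge_atTop t] with s hs hts hp
  exact hr (hp t (by omega) hmt (heq.trans hs.symm))

theorem TrulyPermitted.eventually_responded {m : ℕ}
    (ha : ∀ n, ∀ᶠ s in atTop, (a s n = true ↔ n ∈ A)) (h : TrulyPermitted A a W p m) :
    ∀ᶠ s in atTop, Responded W p m s := by
  filter_upwards [eventually_approxSeg ha m, eventually_ge_atTop m] with s hs hms
  exact h s hms hs

theorem isStableNode_zero : IsStableNode a W p 0 [[]] :=
  Eventually.of_forall fun _ => rfl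

/-- Take the least truly permitted block of the node: the earlier ones lose permission in the limit,
so the scan reaches this block unmoved and then moves on. -/
theorem IsStableNode.exists_next (ha : ∀ n, ∀ᶠ s in atTop, (a s n = true ↔ n ∈ A))
    (hW : ∀ x s t, s ≤ t → W s x → W t x) {v : ℕ} {L : List (List Bool)}
    (hv : IsStableNode a W p v L)
    (h : ∃ m, record a W p m = some (v, L) ∧ TrulyPermitted A a W p m) :
    ∃ m L', record a W p m = some (v, L) ∧ TrulyPermitted A a W p m ∧
      IsStableNode a W p (m + 1) L' ∧ ∀ᶠ s in atTop, L' = children W p m s L := by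
  classical
  obtain ⟨hm, hmp⟩ := Nat.find_spec h
  have hmin := fun k (hk : k < Nat.find h) => Nat.find_min h hk
  generalize Nat.find h = m at hm hmp hmin
  obtain ⟨s₀, hs₀⟩ := (hmp.eventually_responded ha).exists
  have hch : ∀ᶠ s in atTop, children W p m s₀ L = children W p m s L := by
    filter_upwards [hmp.eventually_responded ha] with s hs
    exact children_congr hW hs₀ hs L
  refine ⟨m, children W p m s₀ L, hm, hmp, ?_, hch⟩
  have hno : ∀ᶠ s in atTop, ∀ k ∈ Finset.range m, record a W p k = some (v, L) →
      ¬ Permitted a W p k s := by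
    rw [Filter.eventually_all_finset]
    intro k hk
    by_cases hr : record a W p k = some (v, L)
    · have := hmin k (Finset.mem_range.1 hk)
      filter_upwards [eventually_not_permitted ha fun h' => this ⟨hr, h'⟩] with s hs _
      exact hs
    · exact Eventually.of_forall fun s h' => absurd h' hr
  filter_upwards [hv, hch, hno, hmp.eventually ha] with s h1 h2 h3 h4
  obtain ⟨g1, g2, -⟩ := scan_stay (record a W p) h1 (record_eq_some_le hm)
    fun k hk => h3 k (Finset.mem_range.2 hk)
  rw [scan, g1, g2, if_pos hm, if_pos h4, ← h2]

/-- If infinitely many blocks belong to the same node, and none of them is truly permitted, then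
`A` is recursive. -/
theorem isRecursive_of_infinite_records (haP : Primrec₂ a) (hrP : Primrec (record a W p))
    (ha : ∀ n, ∀ᶠ s in atTop, (a s n = true ↔ n ∈ A))
    (hW : ∀ x s t, s ≤ t → W s x → W t x) {v : ℕ} {L : List (List Bool)}
    (hinf : {m | record a W p m = some (v, L)}.Infinite)
    (hno : ∀ m, record a W p m = some (v, L) → ¬ TrulyPermitted A a W p m) :
    IsRecursive A := by
  have hu1 : Primrec fun q : ℕ × ℕ => q.2.unpair.1 :=
    Primrec.fst.comp (Primrec.unpair.comp Primrec.snd)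
  have hu2 : Primrec fun q : ℕ × ℕ => q.2.unpair.2 :=
    Primrec.snd.comp (Primrec.unpair.comp Primrec.snd)
  -- Search for blocks `m < m'` of the node, beyond `n`, with a constant guess about `n` on `[m,
  -- m')`. `W` has responded in `m` by stage `m'`, but `m` is not truly permitted, so this interval
  -- contains a stage correct on the first `m` bits.
  refine isRecursive_of_search (P := fun n w => (record a W p w.unpair.1 = some (v, L) ∧
    record a W p w.unpair.2 = some (v, L)) ∧ n < w.unpair.1 ∧ w.unpair.1 < w.unpair.2 ∧
    ∀ t < w.unpair.2, w.unpair.1 ≤ t → a t n = a w.unpair.1 n)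
    (val := fun n w => a w.unpair.1 n) ?_ (haP.comp hu1 Primrec.fst) ?_ ?_
  · refine PrimrecPred.and (PrimrecPred.and ?_ ?_) (PrimrecPred.and ?_ (PrimrecPred.and ?_ ?_))
    · exact PrimrecRel.comp Primrec.eq (hrP.comp hu1) (Primrec.const _)
    · exact PrimrecRel.comp Primrec.eq (hrP.comp hu2) (Primrec.const _)
    · exact PrimrecRel.comp Primrec.nat_lt Primrec.fst hu1
    · exact PrimrecRel.comp Primrec.nat_lt hu1 hu2
    · refine primrecPred_ball_lt (α := ℕ × ℕ) (R := fun q t => q.2.unpair.1 ≤ t →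
        a t q.1 = a q.2.unpair.1 q.1) hu2 (primrecPred_imp ?_ ?_)
      · exact PrimrecRel.comp Primrec.nat_le (hu1.comp Primrec.fst) Primrec.snd
      · exact PrimrecRel.comp Primrec.eq (haP.comp Primrec.snd (Primrec.fst.comp Primrec.fst))
          (haP.comp (hu1.comp Primrec.fst) (Primrec.fst.comp Primrec.fst))
  · intro n
    obtain ⟨s₀, hs₀⟩ := eventually_atTop.1 (ha n)
    obtain ⟨m, hm, hmn⟩ := hinf.exists_gt (max n s₀)
    obtain ⟨m', hm', hmm'⟩ := hinf.exists_gt m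
    have h1 : n < m := lt_of_le_of_lt (le_max_left _ _) hmn
    have h2 : s₀ < m := lt_of_le_of_lt (le_max_right _ _) hmn
    refine ⟨Nat.pair m m', ?_⟩
    simp only [Nat.unpair_pair]
    refine ⟨⟨hm, hm'⟩, h1, hmm', fun t _ hmt => ?_⟩
    rw [Bool.eq_iff_iff, hs₀ t (by omega), hs₀ m (by omega)]
  · rintro n w ⟨⟨hm, hm'⟩, hnm, hmm', hconst⟩
    have := hno _ hm
    simp only [TrulyPermitted, not_forall] at this
    obtain ⟨t, hmt, heq, hr⟩ := this
    have htm' : t < w.unpair.2 := by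
      by_contra hle
      exact hr ((responded_of_record hmm' hm hm').mono hW (not_lt.1 hle))
    rw [← hconst t htm' hmt]
    exact approxSeg_eq_initSeg.1 heq n hnm

/-- If finitely many blocks belong to a stable node, and none of them is truly permitted, then
one of them never gets a response, and the construction stops. -/
theorem IsStableNode.exists_not_responded (ha : ∀ n, ∀ᶠ s in atTop, (a s n = true ↔ n ∈ A))
    (hW : ∀ x s t, s ≤ t → W s x → W t x) {v : ℕ} {L : List (List Bool)}
    (hv : IsStableNode a W p v L) (hfin : {m | record a W p m = some (v, L)}.Finite)
    (hno : ∀ m, record a W p m = some (v, L) → ¬ TrulyPermitted A a W p m) :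
    (∃ m, record a W p m = some (v, L) ∧ ∀ s, ¬ Responded W p m s) ∧
      ∀ᶠ s in atTop, record a W p s = none := by
  have h1 : ∀ᶠ s in atTop, ∀ m ∈ hfin.toFinset, ¬ Permitted a W p m s := by
    rw [Filter.eventually_all_finset]
    intro m hm
    exact eventually_not_permitted ha (hno m (by simpa using hm))
  have h2 : ∀ᶠ s in atTop, (scan a W p (record a W p) s s).1 = v ∧
      (scan a W p (record a W p) s s).2.1 = L ∧
      ((∀ m < s, record a W p m = some (v, L) → Responded W p m s) →
        (scan a W p (record a W p) s s).2.2 = false) := by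
    filter_upwards [hv, h1, eventually_ge_atTop v] with s g1 g2 g3
    exact scan_stay _ g1 g3 fun m _ hm => g2 m (by simpa using hm)
  have h3 : ∀ᶠ s in atTop, record a W p s ≠ some (v, L) := by
    have := hfin.eventually_cofinite_notMem
    rw [Nat.cofinite_eq_atTop] at this
    exact this
  -- Late scans end at this node, whose finitely many blocks are used up.
  have h4 : ∀ᶠ s in atTop, record a W p s = none := by
    filter_upwards [h2, h3] with s g2 g3
    by_contra hne
    obtain ⟨⟨v', L'⟩, hrec⟩ := Option.ne_none_iff_exists'.1 hne
    have := (record_eq_some hrec).2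
    rw [this] at g2
    obtain ⟨rfl, rfl, -⟩ := g2
    exact g3 hrec
  refine ⟨?_, h4⟩
  -- If all its blocks responded, a late scan would end with the flag down and create a record.
  by_contra hcon
  push Not at hcon
  have h5 : ∀ᶠ s in atTop, ∀ m ∈ hfin.toFinset, Responded W p m s := by
    rw [Filter.eventually_all_finset]
    intro m hm
    obtain ⟨s, hs⟩ := hcon m (by simpa using hm)
    filter_upwards [eventually_ge_atTop s] with t ht
    exact hs.mono hW ht
  obtain ⟨s, g2, g4, g5, g6⟩ := (h2.and (h4.and (h5.and (eventually_ge_atTop (2 * p))))).exists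
  have : (scan a W p (record a W p) s s).2.2 = false :=
    g2.2.2 fun m _ hm => g5 m (by simpa using hm)
  rw [record_eq, nextRecord, if_pos ⟨g6, this⟩] at g4
  simp at g4

/-- Nonrecursiveness of `A` excludes infinitely many unpermitted blocks, so a node without successor
is stuck at a block that never responds. -/
theorem IsStableNode.next_or_eventually_none (hA : ¬ IsRecursive A) (haP : Primrec₂ a)
    (hrP : Primrec (record a W p)) (ha : ∀ n, ∀ᶠ s in atTop, (a s n = true ↔ n ∈ A))
    (hW : ∀ x s t, s ≤ t → W s x → W t x) {v : ℕ} {L : List (List Bool)}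
    (hv : IsStableNode a W p v L) :
    (∃ m L', record a W p m = some (v, L) ∧ TrulyPermitted A a W p m ∧
      IsStableNode a W p (m + 1) L' ∧ ∀ᶠ s in atTop, L' = children W p m s L) ∨
    ((∃ m, record a W p m = some (v, L) ∧ ∀ s, ¬ Responded W p m s) ∧
      ∀ᶠ s in atTop, record a W p s = none) := by
  by_cases h : ∃ m, record a W p m = some (v, L) ∧ TrulyPermitted A a W p m
  · exact Or.inl (hv.exists_next ha hW h)
  · right
    have hno : ∀ m, record a W p m = some (v, L) → ¬ TrulyPermitted A a W p m :=
      fun m hm hp => h ⟨m, hm, hp⟩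
    refine hv.exists_not_responded ha hW ?_ hno
    by_contra hinf
    exact hA (isRecursive_of_infinite_records haP hrP ha hW hinf hno)

/-- The infinite true path of a construction that does not stop: at the `i`-th node `v i`, with
list of strings `L i`, the block `m i` is truly permitted. -/
structure IsTruePath (A : Set ℕ) (a : ℕ → ℕ → Bool) (W : ℕ → ℕ → Prop) (p : ℕ)
    (v : ℕ → ℕ) (L : ℕ → List (List Bool)) (m : ℕ → ℕ) : Prop where
  zero : L 0 = [[]]
  succ : ∀ i, v (i + 1) = m i + 1
  stable : ∀ i, IsStableNode a W p (v i) (L i)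
  record : ∀ i, record a W p (m i) = some (v i, L i)
  permitted : ∀ i, TrulyPermitted A a W p (m i)
  children : ∀ i, ∀ᶠ s in atTop, L (i + 1) = children W p (m i) s (L i)

theorem exists_isTruePath
    (h : ∀ v L, IsStableNode a W p v L → ∃ m L', record a W p m = some (v, L) ∧
      TrulyPermitted A a W p m ∧ IsStableNode a W p (m + 1) L' ∧
      ∀ᶠ s in atTop, L' = children W p m s L) :
    ∃ v L m, IsTruePath A a W p v L m := by
  choose f g h1 h2 h3 h4 using h
  let node : ℕ → {q : ℕ × List (List Bool) // IsStableNode a W p q.1 q.2} := fun i =>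
    Nat.rec ⟨(0, [[]]), isStableNode_zero⟩
      (fun _ q => ⟨(f q.1.1 q.1.2 q.2 + 1, g q.1.1 q.1.2 q.2), h3 _ _ _⟩) i
  exact ⟨fun i => (node i).1.1, fun i => (node i).1.2,
    fun i => f (node i).1.1 (node i).1.2 (node i).2, rfl, fun i => rfl, fun i => (node i).2,
    fun i => h1 _ _ _, fun i => h2 _ _ _, fun i => h4 _ _ _⟩

/-! ### Length and width of the levels of the true path -/

namespace IsTruePath

variable {v : ℕ → ℕ} {L : ℕ → List (List Bool)} {m : ℕ → ℕ}

theorem length_eq (h : IsTruePath A a W p v L m) (i : ℕ) : ∀ σ ∈ L i, σ.length = i := by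
  induction i with
  | zero => rw [h.zero]; simp
  | succ i ih =>
    obtain ⟨s, hs⟩ := (h.children i).exists
    rw [hs]
    intro σ hσ
    obtain ⟨j, ρ, b, hj, -, rfl⟩ := mem_children.1 hσ
    simp [ih ρ (List.mem_of_getElem? hj)]

theorem width_le (h : IsTruePath A a W p v L m)
    (ha : ∀ n, ∀ᶠ s in atTop, (a s n = true ↔ n ∈ A))
    (hW : ∀ x s t, s ≤ t → W s x → W t x) (i : ℕ) : (L i).length ≤ 2 ^ p := by
  induction i with
  | zero => rw [h.zero]; exact Nat.one_le_two_pow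
  | succ i ih =>
    obtain ⟨s, hs, hr⟩ := ((h.children i).and ((h.permitted i).eventually_responded ha)).exists
    rw [hs]
    exact length_children_le hW hr ih

theorem le_node (h : IsTruePath A a W p v L m) (i : ℕ) : i ≤ v i := by
  induction i with
  | zero => exact Nat.zero_le _
  | succ i ih =>
    rw [h.succ]
    have := record_eq_some_le (h.record i)
    omega

theorem node_le_block (h : IsTruePath A a W p v L m) (i : ℕ) : v i ≤ m i :=
  record_eq_some_le (h.record i)

end IsTruePath

/-! ### Activity -/

/-- The block `m` is active for the oracle `X`: it is recorded with an initial segment of `X`. -/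
def Active (a : ℕ → ℕ → Bool) (W : ℕ → ℕ → Prop) (p : ℕ) (X : Set ℕ) (m : ℕ) : Prop :=
  ∃ v L, record a W p m = some (v, L) ∧ ∃ σ ∈ L, σ <+: initSeg X m

/-- An active block `s` was recorded with the list of the full scan at stage `s`; `scan_prefix`
takes its prefix of `X` back to position `k`. -/
theorem frequently_exists_prefix {X : Set ℕ} (hX : {m | Active a W p X m}.Infinite) (k : ℕ) :
    ∃ᶠ s in atTop, ∃ σ ∈ (scan a W p (record a W p) s k).2.1, σ <+: initSeg X s := by
  have h := Nat.frequently_atTop_iff_infinite.2 hX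
  refine (h.and_eventually (eventually_ge_atTop k)).mono ?_
  rintro s ⟨⟨v, L, hr, σ, hσ, hpre⟩, hks⟩
  obtain ⟨ρ, hρ, hρσ⟩ := scan_prefix (record a W p) s hks σ
    (by rw [(record_eq_some hr).2]; exact hσ)
  exact ⟨ρ, hρ, hρσ.trans hpre⟩

/-- A set that is active infinitely often is `Δ⁰₂`. -/
theorem isDelta02_of_infinite_active (hA : ¬ IsRecursive A) (haP : Primrec₂ a)
    (hrP : Primrec (record a W p))
    (hsP : Primrec₂ fun s k => scan a W p (record a W p) s k)
    (ha : ∀ n, ∀ᶠ s in atTop, (a s n = true ↔ n ∈ A))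
    (hW : ∀ x s t, s ≤ t → W s x → W t x) {X : Set ℕ}
    (hX : {m | Active a W p X m}.Infinite) : IsDelta02 X := by
  obtain ⟨v, L, m, h⟩ : ∃ v L m, IsTruePath A a W p v L m := by
    refine exists_isTruePath fun v L hv => ?_
    refine (hv.next_or_eventually_none hA haP hrP ha hW).resolve_right ?_
    rintro ⟨-, hnone⟩
    obtain ⟨s, ⟨v', L', hr, -⟩, hs⟩ :=
      ((Nat.frequently_atTop_iff_infinite.2 hX).and_eventually hnone).exists
    rw [hs] at hr
    simp at hr
  obtain ⟨c, hc⟩ := exists_isolating_initSeg (X := X) (h.width_le ha hW)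
  -- Every listed string compatible with the isolating segment has bit `b` at `n`. That segment is a
  -- fixed finite string, so no oracle is needed.
  let Q : Bool → ℕ → ℕ → ℕ → Prop := fun b n k s =>
    ∀ σ ∈ (scan a W p (record a W p) s k).2.1,
      (σ = (initSeg X c).take σ.length ∨ initSeg X c = σ.take (initSeg X c).length) →
        σ[n]? = some b
  have key : ∀ (b : Bool) (n : ℕ), (b = true ↔ n ∈ X) ↔ ∃ k, ∀ᶠ s in atTop, Q b n k s := by
    intro b n
    constructor
    · intro hb
      -- Strings at level `i ≥ c` have length `i`, so the compatible ones extend the isolating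
      -- segment.
      obtain ⟨i, hi, hσ⟩ := hc n
      refine ⟨v i, ?_⟩
      filter_upwards [h.stable i] with s hs σ hσL hcomp
      rw [hs] at hσL
      have hlen := h.length_eq i σ hσL
      have hpre : initSeg X c <+: σ := by
        rcases hcomp with h1 | h1
        · rw [List.take_of_length_le (by rw [length_initSeg]; omega)] at h1
          rw [h1]
        · exact List.prefix_iff_eq_take.2 h1
      obtain ⟨b', hb', hb''⟩ := hσ σ hσL hpre
      rw [hb', Bool.eq_iff_iff.2 (hb''.trans hb.symm)]
    -- By activity, infinitely many stages list a prefix of `X`. It is compatible, so its bit at `n`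
    -- is that of `X`.
    · rintro ⟨k, hk⟩
      obtain ⟨s, ⟨σ, hσ, hpre⟩, hs, hcs⟩ := ((frequently_exists_prefix hX k).and_eventually
        (hk.and (eventually_ge_atTop c))).exists
      have hcomp := List.prefix_or_prefix_of_prefix hpre (initSeg_prefix X hcs)
      rw [List.prefix_iff_eq_take, List.prefix_iff_eq_take] at hcomp
      have h1 := hs σ hσ hcomp
      obtain ⟨t, ht⟩ := hpre
      have hn : n < σ.length := by
        by_contra hn
        rw [List.getElem?_eq_none (by omega)] at h1
        simp at h1
      have h2 : (initSeg X s)[n]? = some b := by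
        rw [← ht, List.getElem?_append_left hn, h1]
      have hns : n < s := by
        have := congrArg List.length ht
        rw [List.length_append, length_initSeg] at this
        omega
      obtain ⟨b', hb', hb''⟩ := getElem?_initSeg (X := X) hns
      rw [hb'] at h2
      rw [← hb'', Option.some.inj h2]
  have hprim : ∀ b : Bool, PrimrecPred fun q : ℕ × ℕ × ℕ => Q b q.1 q.2.1 q.2.2 := by
    intro b
    refine primrecPred_ball_mem (α := ℕ × ℕ × ℕ)
      (f := fun q => (scan a W p (record a W p) q.2.2 q.2.1).2.1)
      (R := fun q σ => (σ = (initSeg X c).take σ.length ∨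
        initSeg X c = σ.take (initSeg X c).length) → σ[q.1]? = some b) ?_ ?_
    · exact Primrec.fst.comp (Primrec.snd.comp (hsP.comp (Primrec.snd.comp Primrec.snd)
        (Primrec.fst.comp Primrec.snd)))
    · refine primrecPred_imp (PrimrecPred.or ?_ ?_) ?_
      · exact PrimrecRel.comp Primrec.eq Primrec.snd (Primrec.list_take.comp
          (Primrec.list_length.comp Primrec.snd) (Primrec.const _))
      · exact PrimrecRel.comp Primrec.eq (Primrec.const _) (Primrec.list_take.comp
          (Primrec.const _) Primrec.snd)
      · exact PrimrecRel.comp Primrec.eq (Primrec.list_getElem?.comp Primrec.snd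
          (Primrec.fst.comp Primrec.fst)) (Primrec.const _)
  constructor
  · refine isSigma02_of_eventually (P := Q _) (hprim true) fun n => ?_
    rw [← key true n]
    simp
  · refine IsSigma02.isPi02_of_compl (isSigma02_of_eventually (P := Q _) (hprim false) fun n => ?_)
    rw [← key false n]
    simp

/-! ### Meeting a responding set -/

/-- `x` is the least frozen element of its residue class in the block `m`, at stage `s`. -/
def Chosen (W : ℕ → ℕ → Prop) (p m s x : ℕ) : Prop :=
  Responded W p m s ∧ Frozen W p m s x ∧
    ∀ y < x, InBlock m y → y % 2 ^ p = x % 2 ^ p → ¬ Frozen W p m s y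

/-- The residue of `x` modulo `2 ^ p` is the first index of a string in `L` that is a prefix
of `l`. -/
def Selected (p : ℕ) (L : List (List Bool)) (l : List Bool) (x : ℕ) : Prop :=
  x % 2 ^ p < L.length ∧ L.getD (x % 2 ^ p) [] <+: l ∧
    ∀ j < x % 2 ^ p, ¬ L.getD j [] <+: l

/-- If `W` responds in all blocks, then it contains an element of an active block for `X` that is
in the residue class of an initial segment of `X`, and is chosen whenever the first bits of `A`
are approximated correctly. -/
theorem exists_mem_omitted (hA : ¬ IsRecursive A) (haP : Primrec₂ a)
    (hrP : Primrec (record a W p)) (ha : ∀ n, ∀ᶠ s in atTop, (a s n = true ↔ n ∈ A))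
    (hW : ∀ x s t, s ≤ t → W s x → W t x) {X : Set ℕ}
    (hX : {m | Active a W p X m}.Finite) (hresp : ∀ m ≥ 2 * p, ∃ s, Responded W p m s) :
    ∃ m x, 2 * p ≤ m ∧ InBlock m x ∧ (∃ s, W s x) ∧
      (∀ s ≥ m, approxSeg a s m = initSeg A m → Chosen W p m s x) ∧
      ∃ v L, record a W p m = some (v, L) ∧ Selected p L (initSeg X m) x := by
  classical
  obtain ⟨v, L, m, h⟩ : ∃ v L m, IsTruePath A a W p v L m := by
    refine exists_isTruePath fun v L hv => ?_
    refine (hv.next_or_eventually_none hA haP hrP ha hW).resolve_right ?_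
    rintro ⟨⟨m, hm, hno⟩, -⟩
    obtain ⟨s, hs⟩ := hresp m (record_eq_some hm).1
    exact hno s hs
  -- Otherwise every block of the true path would be active for `X`.
  have hout : ∃ i, initSeg X i ∉ L i := by
    by_contra hcon
    push Not at hcon
    have hmono : StrictMono m := strictMono_nat_of_lt_succ fun i => by
      have := h.node_le_block (i + 1)
      rw [h.succ] at this
      omega
    refine Set.infinite_of_injective_forall_mem hmono.injective (fun i => ?_) hX
    exact ⟨v i, L i, h.record i, _, hcon i,
      initSeg_prefix X ((h.le_node i).trans (h.node_le_block i))⟩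
  obtain ⟨i, hi, hi'⟩ : ∃ i, initSeg X i ∈ L i ∧ initSeg X (i + 1) ∉ L (i + 1) := by
    by_contra hcon
    push Not at hcon
    obtain ⟨i, hi⟩ := hout
    refine hi ?_
    clear hi
    induction i with
    | zero => simp [h.zero, initSeg]
    | succ i ih => exact hcon i ih
  have hjlt : (L i).idxOf (initSeg X i) < (L i).length := List.idxOf_lt_length_of_mem hi
  have hget : (L i)[(L i).idxOf (initSeg X i)]? = some (initSeg X i) := by
    rw [List.getElem?_eq_getElem hjlt, List.getElem_idxOf]
  have hsel : ∀ j < (L i).idxOf (initSeg X i), ¬ (L i).getD j [] <+: initSeg X (m i) := by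
    intro j hj hpre
    rw [List.getD_eq_getElem _ _ (hj.trans hjlt)] at hpre
    have h1 := eq_initSeg_of_prefix hpre
    rw [h.length_eq i _ (List.getElem_mem _)] at h1
    have h2 := List.not_of_lt_findIdx (p := (· == initSeg X i)) hj
    simp [h1] at h2
  have hpre := initSeg_prefix X ((h.le_node i).trans (h.node_le_block i))
  generalize (L i).idxOf (initSeg X i) = j at hjlt hget hsel
  obtain ⟨s, hs, hr⟩ := ((h.children i).and ((h.permitted i).eventually_responded ha)).exists
  -- Had the class not been hit, both extensions of `initSeg X i` would be in the next list.
  have hhit : Hit W p (m i) s j := by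
    by_contra hno
    obtain ⟨b, hb, -⟩ := initSeg_succ X i
    exact hi' (hs ▸ mem_children.2 ⟨j, _, b, hget, hno, hb⟩)
  have hex : ∃ x, InBlock (m i) x ∧ x % 2 ^ p = j ∧ Frozen W p (m i) s x := by
    obtain ⟨x, -, hx⟩ := hhit
    exact ⟨x, hx⟩
  obtain ⟨hx1, hx2, hx3⟩ := Nat.find_spec hex
  have hmin := fun y (hy : y < Nat.find hex) => Nat.find_min hex hy
  generalize Nat.find hex = x at hx1 hx2 hx3 hmin
  refine ⟨m i, x, (record_eq_some (h.record i)).1, hx1, ⟨s, hx3 s (by omega) hr⟩, ?_,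
    v i, L i, h.record i, by rw [hx2]; exact hjlt, ?_, by rw [hx2]; exact hsel⟩
  swap
  · rw [hx2, List.getD_eq_getElem?_getD, hget]
    exact hpre
  -- True permission gives a response at each correct stage, and the frozen part is always the same.
  intro t hmt heq
  have hrt := h.permitted i t hmt heq
  refine ⟨hrt, (frozen_congr hW hr hrt).1 hx3, fun y hy hby hmod hfr => ?_⟩
  exact hmin y hy ⟨hby, hmod.trans hx2, (frozen_congr hW hr hrt).2 hfr⟩

end Limit

/-! ### Density -/

theorem ncard_inter_Iio_add_compl (S : Set ℕ) (n : ℕ) :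
    (S ∩ Set.Iio n).ncard + (Sᶜ ∩ Set.Iio n).ncard = n := by
  have h := Set.ncard_inter_add_ncard_sdiff_eq_ncard (Set.Iio n) S (Set.finite_Iio n)
  have hn : (Set.Iio n).ncard = n := by
    rw [← Finset.coe_Iio, Set.ncard_coe_finset, Nat.card_Iio]
  rw [hn] at h
  rw [Set.inter_comm S, Set.inter_comm Sᶜ]
  exact h

/-- A set has density `1` if its complement is covered by sets of density `0` whose relative
frequencies are summably bounded. -/
theorem hasDensityOne_of_compl_subset {S : Set ℕ} {O : ℕ → Set ℕ} (hS : Sᶜ ⊆ ⋃ p, O p)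
    (h0 : ∀ p, Tendsto (fun n : ℕ => ((O p ∩ Set.Iio n).ncard : ℝ) / n) atTop (𝓝 0))
    (hb : ∀ p n, (O p ∩ Set.Iio n).ncard * 2 ^ p ≤ 2 * n) : HasDensityOne S := by
  have hfr : ∀ p n, ((O p ∩ Set.Iio n).ncard : ℝ) / n ≤ 2 * (1 / 2) ^ p := by
    intro p n
    have h : ((O p ∩ Set.Iio n).ncard : ℝ) * 2 ^ p ≤ 2 * n := by exact_mod_cast hb p n
    refine div_le_of_le_mul₀ (by positivity) (by positivity) ?_
    rw [one_div, inv_pow, ← mul_le_mul_iff_left₀ (show (0 : ℝ) < 2 ^ p by positivity)]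
    refine h.trans (le_of_eq ?_)
    field_simp
  have hsum : Summable fun p : ℕ => (2 : ℝ) * (1 / 2) ^ p :=
    summable_geometric_two.mul_left 2
  have hlim : Tendsto (fun n : ℕ => ∑' p, ((O p ∩ Set.Iio n).ncard : ℝ) / n) atTop (𝓝 0) := by
    have := tendsto_tsum_of_dominated_convergence (β := ℕ) (𝓕 := atTop)
      (f := fun n p => ((O p ∩ Set.Iio n).ncard : ℝ) / n) (g := fun _ => (0 : ℝ)) hsum h0
      (Eventually.of_forall fun n p => by
        rw [Real.norm_of_nonneg (by positivity)]
        exact hfr p n)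
    simpa using this
  have hcard : ∀ n : ℕ, ((Sᶜ ∩ Set.Iio n).ncard : ℝ) / n ≤
      ∑' p, ((O p ∩ Set.Iio n).ncard : ℝ) / n := by
    intro n
    -- If `O p` meets `[0, n)` then `2 ^ p ≤ 2 * n`, hence `p ≤ n`.
    have hsub : Sᶜ ∩ Set.Iio n ⊆ ⋃ p ∈ Finset.range (n + 1), (O p ∩ Set.Iio n) := by
      rintro x ⟨hx, hxn⟩
      obtain ⟨p, hp⟩ := Set.mem_iUnion.1 (hS hx)
      refine Set.mem_iUnion₂.2 ⟨p, ?_, hp, hxn⟩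
      rw [Finset.mem_range]
      by_contra hnp
      have h1 : 1 ≤ (O p ∩ Set.Iio n).ncard :=
        (Set.ncard_pos ((Set.finite_Iio n).inter_of_right _)).2 ⟨x, hp, hxn⟩
      have h2 : 2 * (n + 1) ≤ 2 ^ p * 2 := by
        have h3 : n + 1 < 2 ^ (n + 1) := Nat.lt_two_pow_self
        have h4 : 2 ^ (n + 1) ≤ 2 ^ p := Nat.pow_le_pow_right (by norm_num) (by omega)
        omega
      have h3 := hb p n
      have h4 : 1 * 2 ^ p ≤ (O p ∩ Set.Iio n).ncard * 2 ^ p := Nat.mul_le_mul_right _ h1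
      have h5 : n + 1 < 2 ^ (n + 1) := Nat.lt_two_pow_self
      have h6 : 2 ^ (n + 1) ≤ 2 ^ p := Nat.pow_le_pow_right (by norm_num) (by omega)
      have h7 : n < 2 ^ n := Nat.lt_two_pow_self
      rw [pow_succ] at h6
      omega
    have h1 : (Sᶜ ∩ Set.Iio n).ncard ≤ ∑ p ∈ Finset.range (n + 1), (O p ∩ Set.Iio n).ncard := by
      refine (Set.ncard_le_ncard hsub ?_).trans (Finset.set_ncard_biUnion_le _ _)
      exact Set.Finite.biUnion (Finset.finite_toSet _)
        fun p _ => (Set.finite_Iio n).inter_of_right _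
    calc ((Sᶜ ∩ Set.Iio n).ncard : ℝ) / n
        ≤ (∑ p ∈ Finset.range (n + 1), ((O p ∩ Set.Iio n).ncard : ℝ)) / n := by
          gcongr
          exact_mod_cast h1
      _ = ∑ p ∈ Finset.range (n + 1), ((O p ∩ Set.Iio n).ncard : ℝ) / n := by
          rw [Finset.sum_div]
      _ ≤ _ := by
          refine Summable.sum_le_tsum _ (fun p _ => by positivity) ?_
          exact Summable.of_nonneg_of_le (fun p => by positivity) (fun p => hfr p n) hsum
  have hc : Tendsto (fun n : ℕ => ((Sᶜ ∩ Set.Iio n).ncard : ℝ) / n) atTop (𝓝 0) :=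
    squeeze_zero (fun n => by positivity) hcard hlim
  have h1 : Tendsto (fun n : ℕ => 1 - ((Sᶜ ∩ Set.Iio n).ncard : ℝ) / n) atTop (𝓝 1) := by
    simpa using hc.const_sub 1
  refine h1.congr' ?_
  filter_upwards [eventually_gt_atTop 0] with n hn
  have h2 : ((S ∩ Set.Iio n).ncard : ℝ) + ((Sᶜ ∩ Set.Iio n).ncard : ℝ) = n := by
    exact_mod_cast ncard_inter_Iio_add_compl S n
  have hn' : (n : ℝ) ≠ 0 := by exact_mod_cast hn.ne'
  rw [eq_div_iff hn', sub_mul, div_mul_cancel₀ _ hn']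
  linarith

/-- A counting bound by an injection into an interval. -/
theorem ncard_mul_le_of_injOn {S : Set ℕ} {f : ℕ → ℕ} (p n : ℕ) (hf : Set.InjOn f S)
    (h1 : ∀ x ∈ S, 1 ≤ f x) (h2 : ∀ x ∈ S, f x * 2 ^ p ≤ 2 * x) :
    (S ∩ Set.Iio n).ncard * 2 ^ p ≤ 2 * n := by
  have h : (S ∩ Set.Iio n).ncard ≤ (Set.Icc 1 (2 * n / 2 ^ p)).ncard := by
    refine Set.ncard_le_ncard_of_injOn f ?_ (hf.mono Set.inter_subset_left) (Set.finite_Icc _ _)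
    rintro x ⟨hx, hxn⟩
    refine ⟨h1 x hx, (Nat.le_div_iff_mul_le (by positivity)).2 ?_⟩
    have := h2 x hx
    have hxn : x < n := hxn
    omega
  have hc : (Set.Icc 1 (2 * n / 2 ^ p)).ncard = 2 * n / 2 ^ p := by
    rw [← Finset.coe_Icc, Set.ncard_coe_finset, Nat.card_Icc]
    exact Nat.add_sub_cancel _ _
  rw [hc] at h
  exact (Nat.mul_le_mul_right _ h).trans (Nat.div_mul_le_self _ _)

theorem tendsto_ncard_div_zero_of_finite {S : Set ℕ} (hS : S.Finite) :
    Tendsto (fun n : ℕ => ((S ∩ Set.Iio n).ncard : ℝ) / n) atTop (𝓝 0) := by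
  refine squeeze_zero (fun n => by positivity) (fun n => ?_)
    (tendsto_const_div_atTop_nhds_zero_nat (S.ncard : ℝ))
  gcongr
  exact Set.inter_subset_left

theorem tendsto_log_div_zero (c : ℝ) :
    Tendsto (fun n : ℕ => ((Nat.log 2 n + 1 : ℕ) * c : ℝ) / n) atTop (𝓝 0) := by
  have h1 : Tendsto (fun n : ℕ => Real.log n / n) atTop (𝓝 0) := by
    have := Real.isLittleO_log_id_atTop.tendsto_div_nhds_zero
    exact this.comp tendsto_natCast_atTop_atTop
  have h2 : Tendsto (fun n : ℕ => (Real.log n / n / Real.log 2 + 1 / n) * |c|) atTop (𝓝 0) := by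
    simpa using ((h1.div_const (Real.log 2)).add
      (tendsto_const_div_atTop_nhds_zero_nat (1 : ℝ))).mul_const |c|
  refine squeeze_zero_norm (fun n => ?_) h2
  rw [norm_div, norm_mul, Real.norm_natCast, Real.norm_natCast, Real.norm_eq_abs]
  have h3 : ((Nat.log 2 n + 1 : ℕ) : ℝ) ≤ Real.log n / Real.log 2 + 1 := by
    push_cast
    have := Real.natLog_le_logb n 2
    rw [Real.logb] at this
    push_cast at this
    linarith
  calc ((Nat.log 2 n + 1 : ℕ) : ℝ) * |c| / n
      ≤ (Real.log n / Real.log 2 + 1) * |c| / n := by gcongr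
    _ = _ := by ring

/-! ### Blocks -/

theorem InBlock.unique {m m' x : ℕ} (h : InBlock m x) (h' : InBlock m' x) : m = m' := by
  have h1 : m < m' + 1 := (Nat.pow_lt_pow_iff_right (by norm_num)).1 (h.1.trans_lt h'.2)
  have h2 : m' < m + 1 := (Nat.pow_lt_pow_iff_right (by norm_num)).1 (h'.1.trans_lt h.2)
  omega

theorem InBlock.lt {m x : ℕ} (h : InBlock m x) : m < x :=
  lt_of_lt_of_le Nat.lt_two_pow_self h.1

theorem InBlock.div {m p x : ℕ} (hp : p ≤ m) (h : InBlock m x) : InBlock (m - p) (x / 2 ^ p) := by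
  constructor
  · rw [Nat.le_div_iff_mul_le (by positivity), ← pow_add]
    convert h.1 using 2
    omega
  · rw [Nat.div_lt_iff_lt_mul (by positivity), ← pow_add]
    convert h.2 using 2
    omega

/-- A set of density `1` responds in almost all blocks. -/
theorem exists_forall_responded {W : ℕ → ℕ → Prop} {S : Set ℕ} (hW : ∀ x s t, s ≤ t → W s x → W t x)
    (hS : ∀ x ∈ S, ∃ s, W s x) (hd : HasDensityOne S) :
    ∃ N, ∀ m ≥ N, ∀ p ≤ m, ∃ s, Responded W p m s := by
  classical
  -- Each missed class puts `2 ^ (m - p)` elements of the block into the complement, so a complement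
  -- below a quarter of `[0, 2 ^ (m + 1))` suffices; `7 / 8` is ample.
  obtain ⟨N, hN⟩ := eventually_atTop.1 (hd.eventually_const_lt (show (7 / 8 : ℝ) < 1 by norm_num))
  refine ⟨N, fun m hm p hp => ?_⟩
  have hmN : N ≤ 2 ^ (m + 1) := by
    have : m + 1 < 2 ^ (m + 1) := Nat.lt_two_pow_self
    omega
  have h1 := hN _ hmN
  rw [lt_div_iff₀ (by positivity)] at h1
  have h2 := ncard_inter_Iio_add_compl S (2 ^ (m + 1))
  have h3 : 8 * (Sᶜ ∩ Set.Iio (2 ^ (m + 1))).ncard < 2 ^ (m + 1) := by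
    have h4 : ((S ∩ Set.Iio (2 ^ (m + 1))).ncard : ℝ) +
        ((Sᶜ ∩ Set.Iio (2 ^ (m + 1))).ncard : ℝ) = ((2 ^ (m + 1) : ℕ) : ℝ) := by exact_mod_cast h2
    have h5 : 8 * ((Sᶜ ∩ Set.Iio (2 ^ (m + 1))).ncard : ℝ) < ((2 ^ (m + 1) : ℕ) : ℝ) := by linarith
    exact_mod_cast h5
  obtain ⟨s, hs⟩ : ∃ s, ∀ x ∈ S, x < 2 ^ (m + 1) → W s x := by
    have : ∀ᶠ s in atTop, ∀ x ∈ Finset.range (2 ^ (m + 1)), x ∈ S → W s x := by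
      rw [Filter.eventually_all_finset]
      intro x _
      by_cases hx : x ∈ S
      · obtain ⟨s, hs⟩ := hS x hx
        filter_upwards [eventually_ge_atTop s] with t ht _
        exact hW x s t ht hs
      · exact Eventually.of_forall fun s h => absurd h hx
    obtain ⟨s, hs⟩ := this.exists
    exact ⟨s, fun x hx hlt => hs x (Finset.mem_range.2 hlt) hx⟩
  refine ⟨s, ?_⟩
  have hpow : 2 ^ (m - p) * 2 ^ p = 2 ^ m := by
    rw [← pow_add]
    congr 1
    omega
  have hnd : (missedList W p m s).Nodup := List.Nodup.filter _ List.nodup_range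
  let M : Finset ℕ := (missedList W p m s).toFinset
  have hM : M.card = (missedList W p m s).length := List.toFinset_card_of_nodup hnd
  have hmem : ∀ j ∈ M, j < 2 ^ p ∧ Missed W p m s j := by
    intro j hj
    simpa [M, missedList] using hj
  have h4 : (M ×ˢ Finset.range (2 ^ (m - p))).card ≤ (Sᶜ ∩ Set.Iio (2 ^ (m + 1))).ncard := by
    rw [← Set.ncard_coe_finset]
    -- The pair `(j, i)` stands for the `i`-th element of class `j` in the block, counted from `0`.
    refine Set.ncard_le_ncard_of_injOn (fun q => 2 ^ m + (q.2 * 2 ^ p + q.1)) ?_ ?_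
      ((Set.finite_Iio _).inter_of_right _)
    · rintro ⟨j, i⟩ hq
      simp only [Finset.coe_product, Set.mem_prod, Finset.mem_coe, Finset.mem_range] at hq
      obtain ⟨hj, hmiss⟩ := hmem j hq.1
      have hlt : i * 2 ^ p + j < 2 ^ m := by
        rw [← hpow]
        calc i * 2 ^ p + j < i * 2 ^ p + 2 ^ p := by omega
          _ = (i + 1) * 2 ^ p := by ring
          _ ≤ _ := Nat.mul_le_mul_right _ hq.2
      have hlt' : 2 ^ m + (i * 2 ^ p + j) < 2 ^ (m + 1) := by
        rw [pow_succ]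
        omega
      refine ⟨fun hmemS => ?_, hlt'⟩
      refine hmiss _ hlt' ⟨Nat.le_add_right _ _, hlt'⟩ ?_ (hs _ hmemS hlt')
      rw [← hpow, ← add_assoc, ← add_mul, Nat.mul_add_mod_of_lt hj]
    · rintro ⟨j, i⟩ hq ⟨j', i'⟩ hq' heq
      simp only [Finset.coe_product, Set.mem_prod, Finset.mem_coe, Finset.mem_range] at hq hq'
      have hj := (hmem j hq.1).1
      have hj' := (hmem j' hq'.1).1
      have heq : i * 2 ^ p + j = i' * 2 ^ p + j' := by
        simpa using heq
      have h5 := congrArg (· % 2 ^ p) heq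
      simp only [Nat.mul_add_mod_of_lt hj, Nat.mul_add_mod_of_lt hj'] at h5
      subst h5
      have : i * 2 ^ p = i' * 2 ^ p := by omega
      rw [Nat.eq_of_mul_eq_mul_right (by positivity) this]
  rw [Finset.card_product, Finset.card_range, hM] at h4
  change 2 * (missedList W p m s).length ≤ 2 ^ p
  refine Nat.le_of_mul_le_mul_right (c := 2 ^ (m - p)) ?_ (by positivity)
  rw [mul_comm (2 ^ p), hpow]
  have h5 : 2 ^ (m + 1) = 2 ^ m * 2 := pow_succ 2 m
  rw [mul_assoc]
  omega

/-! ### The omitted elements -/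

/-- The elements that are omitted by the generic computations from `X` on behalf of `p`. -/
def Omitted (a : ℕ → ℕ → Bool) (W : ℕ → ℕ → Prop) (p : ℕ) (X : Set ℕ) : Set ℕ :=
  {x | ∃ m v L, InBlock m x ∧ record a W p m = some (v, L) ∧ Selected p L (initSeg X m) x}

/-- The elements that are chosen at some stage in some block, on behalf of `p`. -/
def EverChosen (W : ℕ → ℕ → Prop) (p : ℕ) : Set ℕ :=
  {x | ∃ m s, 2 * p ≤ m ∧ InBlock m x ∧ Chosen W p m s x}

section Omitted

variable {a : ℕ → ℕ → Bool} {W : ℕ → ℕ → Prop} {p : ℕ} {X : Set ℕ}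

theorem Selected.active {m v x : ℕ} {L : List (List Bool)} (hr : record a W p m = some (v, L))
    (h : Selected p L (initSeg X m) x) : Active a W p X m :=
  ⟨v, L, hr, _, by rw [List.getD_eq_getElem _ _ h.1]; exact List.getElem_mem _, h.2.1⟩

theorem Selected.mod_eq {x y : ℕ} {L : List (List Bool)} {l : List Bool} (hx : Selected p L l x)
    (hy : Selected p L l y) : x % 2 ^ p = y % 2 ^ p := by
  rcases lt_trichotomy (x % 2 ^ p) (y % 2 ^ p) with h | h | h
  · exact absurd hx.2.1 (hy.2.2 _ h)
  · exact h
  · exact absurd hy.2.1 (hx.2.2 _ h)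

theorem finite_omitted (hX : {m | Active a W p X m}.Finite) : (Omitted a W p X).Finite := by
  refine (hX.biUnion fun m _ => Set.finite_Iio (2 ^ (m + 1))).subset ?_
  rintro x ⟨m, v, L, hb, hr, hs⟩
  exact Set.mem_biUnion (hs.active hr) hb.2

/-- The quotient by `2 ^ p` determines the block, and each block has a single selected residue. -/
theorem ncard_omitted_mul_le (n : ℕ) : (Omitted a W p X ∩ Set.Iio n).ncard * 2 ^ p ≤ 2 * n := by
  refine ncard_mul_le_of_injOn (f := fun x => x / 2 ^ p) p n ?_ ?_ ?_
  · rintro x ⟨m, v, L, hb, hr, hs⟩ y ⟨m', v', L', hb', hr', hs'⟩ heq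
    have hm := (record_eq_some hr).1
    have hm' := (record_eq_some hr').1
    have h1 := hb.div (p := p) (by omega)
    have h2 := hb'.div (p := p) (by omega)
    rw [show x / 2 ^ p = y / 2 ^ p from heq] at h1
    have h3 := h1.unique h2
    obtain rfl : m = m' := by omega
    rw [hr] at hr'
    obtain ⟨rfl, rfl⟩ := Prod.mk.inj (Option.some.inj hr')
    rw [← Nat.div_add_mod x (2 ^ p), ← Nat.div_add_mod y (2 ^ p), hs.mod_eq hs',
      show x / 2 ^ p = y / 2 ^ p from heq]
  · rintro x ⟨m, v, L, hb, hr, hs⟩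
    have hm := (record_eq_some hr).1
    exact Nat.one_le_two_pow.trans (hb.div (p := p) (by omega)).1
  · intro x _
    have := Nat.div_mul_le_self x (2 ^ p)
    change x / 2 ^ p * 2 ^ p ≤ 2 * x
    omega

theorem Chosen.eq_of_mod_eq (hW : ∀ x s t, s ≤ t → W s x → W t x) {m s t x y : ℕ}
    (hx : Chosen W p m s x) (hy : Chosen W p m t y) (hbx : InBlock m x) (hby : InBlock m y)
    (h : x % 2 ^ p = y % 2 ^ p) : x = y := by
  rcases lt_trichotomy x y with hlt | heq | hlt
  · exact absurd ((frozen_congr hW hx.1 hy.1).1 hx.2.1) (hy.2.2 x hlt hbx h)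
  · exact heq
  · exact absurd ((frozen_congr hW hy.1 hx.1).1 hy.2.1) (hx.2.2 y hlt hby h.symm)

/-- Each class of a block has at most one chosen element. The injection squeezes the choices of
block `m` into block `m - p`, where `2 ^ p` residues fit because `2 * p ≤ m`. -/
theorem ncard_everChosen_mul_le (hW : ∀ x s t, s ≤ t → W s x → W t x) (n : ℕ) :
    (EverChosen W p ∩ Set.Iio n).ncard * 2 ^ p ≤ 2 * n := by
  have hlog : ∀ m x, InBlock m x → Nat.log 2 x = m := fun m x hb =>
    Nat.log_eq_of_pow_le_of_lt_pow hb.1 hb.2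
  have hlt : ∀ m x, 2 * p ≤ m → x % 2 ^ p < 2 ^ (m - p) := fun m x hm =>
    (Nat.mod_lt x (by positivity)).trans_le (Nat.pow_le_pow_right (by norm_num) (by omega))
  have hblock : ∀ m x, 2 * p ≤ m → InBlock (m - p) (2 ^ (m - p) + x % 2 ^ p) := fun m x hm =>
    ⟨Nat.le_add_right _ _, by have := hlt m x hm; rw [pow_succ]; omega⟩
  refine ncard_mul_le_of_injOn (f := fun x => 2 ^ (Nat.log 2 x - p) + x % 2 ^ p) p n ?_ ?_ ?_
  · rintro x ⟨m, s, hm, hb, hc⟩ y ⟨m', s', hm', hb', hc'⟩ heq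
    simp only [hlog _ _ hb, hlog _ _ hb'] at heq
    have h1 := hblock m x hm
    rw [heq] at h1
    have h2 := h1.unique (hblock m' y hm')
    obtain rfl : m = m' := by omega
    exact hc.eq_of_mod_eq hW hc' hb hb' (by omega)
  · intro x _
    exact Nat.one_le_two_pow.trans (Nat.le_add_right _ _)
  · rintro x ⟨m, s, hm, hb, hc⟩
    simp only [hlog _ _ hb]
    have h1 := (hblock m x hm).2
    have h2 : 2 ^ (m - p + 1) * 2 ^ p = 2 * 2 ^ m := by
      rw [← pow_add, ← pow_succ']
      congr 1
      omega
    calc (2 ^ (m - p) + x % 2 ^ p) * 2 ^ p ≤ 2 ^ (m - p + 1) * 2 ^ p :=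
          Nat.mul_le_mul_right _ h1.le
      _ = 2 * 2 ^ m := h2
      _ ≤ 2 * x := Nat.mul_le_mul_left 2 hb.1

/-- There are at most `2 ^ p` choices in each of logarithmically many blocks. -/
theorem tendsto_ncard_everChosen (hW : ∀ x s t, s ≤ t → W s x → W t x) :
    Tendsto (fun n : ℕ => ((EverChosen W p ∩ Set.Iio n).ncard : ℝ) / n) atTop (𝓝 0) := by
  refine squeeze_zero (fun n => by positivity) (fun n => ?_) (tendsto_log_div_zero (2 ^ p))
  have h : (EverChosen W p ∩ Set.Iio n).ncard ≤ (Nat.log 2 n + 1) * 2 ^ p := by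
    have hc : (((Finset.range (Nat.log 2 n + 1)) ×ˢ Finset.range (2 ^ p) : Finset (ℕ × ℕ)) :
        Set (ℕ × ℕ)).ncard = (Nat.log 2 n + 1) * 2 ^ p := by
      rw [Set.ncard_coe_finset, Finset.card_product, Finset.card_range, Finset.card_range]
    rw [← hc]
    refine Set.ncard_le_ncard_of_injOn (fun x => (Nat.log 2 x, x % 2 ^ p)) ?_ ?_
      (Finset.finite_toSet _)
    · rintro x ⟨-, hxn⟩
      have hxn : x < n := hxn
      have h1 := Nat.log_mono_right (b := 2) hxn.le
      have h2 := Nat.mod_lt x (show 2 ^ p > 0 by positivity)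
      simp only [Finset.coe_product, Set.mem_prod, Finset.mem_coe, Finset.mem_range]
      exact ⟨by omega, h2⟩
    · rintro x ⟨⟨m, s, hm, hb, hc⟩, -⟩ y ⟨⟨m', s', hm', hb', hc'⟩, -⟩ heq
      simp only [Prod.mk.injEq] at heq
      rw [Nat.log_eq_of_pow_le_of_lt_pow hb.1 hb.2,
        Nat.log_eq_of_pow_le_of_lt_pow hb'.1 hb'.2] at heq
      obtain ⟨rfl, hmod⟩ := heq
      exact hc.eq_of_mod_eq hW hc' hb hb' hmod
  gcongr
  exact_mod_cast h

end Omitted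

/-! ### Computability of the generic computations -/

section Compute

variable {a : ℕ → ℕ → Bool} {W : ℕ → ℕ → ℕ → Prop}

theorem primrecPred_selected {α : Type*} [Primcodable α] {p x : α → ℕ} {L : α → List (List Bool)}
    {l : α → List Bool} (hp : Primrec p) (hL : Primrec L) (hl : Primrec l) (hx : Primrec x) :
    PrimrecPred fun c => Selected (p c) (L c) (l c) (x c) := by
  have hpre : PrimrecRel fun σ τ : List Bool => σ <+: τ :=
    (PrimrecRel.comp Primrec.eq Primrec.fst (Primrec.list_take.comp
      (Primrec.list_length.comp Primrec.fst) Primrec.snd)).of_eq fun q =>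
        List.prefix_iff_eq_take.symm
  have hmod : Primrec fun c => x c % 2 ^ p c :=
    Primrec.nat_mod.comp hx (primrec_pow.comp (Primrec.const 2) hp)
  refine (PrimrecRel.comp Primrec.nat_lt hmod (Primrec.list_length.comp hL)).and
    ((hpre.comp ((Primrec.list_getD []).comp hL hmod) hl).and ?_)
  refine primrecPred_ball_lt (R := fun c j => ¬ (L c).getD j [] <+: l c) hmod
    (PrimrecPred.not (hpre.comp ?_ (hl.comp Primrec.fst)))
  exact (Primrec.list_getD []).comp (hL.comp Primrec.fst) Primrec.snd

theorem primrecPred_chosen {α : Type*} [Primcodable α] {p m s x : α → ℕ}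
    (hW : PrimrecPred fun q : ℕ × ℕ × ℕ => W q.1 q.2.1 q.2.2)
    (hp : Primrec p) (hm : Primrec m) (hs : Primrec s) (hx : Primrec x) :
    PrimrecPred fun c => Chosen (W (p c)) (p c) (m c) (s c) (x c) := by
  refine (primrecPred_responded hW hp hm hs).and ((primrecPred_frozen hW hp hm hs hx).and ?_)
  refine primrecPred_ball_lt (R := fun c y => InBlock (m c) y → y % 2 ^ p c = x c % 2 ^ p c →
    ¬ Frozen (W (p c)) (p c) (m c) (s c) y) hx ?_
  have hpow : Primrec fun q : α × ℕ => 2 ^ p q.1 :=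
    primrec_pow.comp (Primrec.const 2) (hp.comp Primrec.fst)
  refine primrecPred_imp (primrecPred_inBlock (hm.comp Primrec.fst) Primrec.snd)
    (primrecPred_imp (PrimrecRel.comp Primrec.eq (Primrec.nat_mod.comp Primrec.snd hpow)
      (Primrec.nat_mod.comp (hx.comp Primrec.fst) hpow)) (PrimrecPred.not ?_))
  exact primrecPred_frozen hW (hp.comp Primrec.fst) (hm.comp Primrec.fst) (hs.comp Primrec.fst)
    Primrec.snd

/-- The complement of the union of the sets `Omitted a (W p) p X` is recursively enumerable in
`X`. -/
theorem exists_recursiveIn_omitted (haP : Primrec₂ a)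
    (hWP : PrimrecPred fun q : ℕ × ℕ × ℕ => W q.1 q.2.1 q.2.2) (X : Set ℕ) :
    ∃ φ : ℕ →. ℕ, Nat.RecursiveIn {oracle X} φ ∧
      φ.Dom = (⋃ p, Omitted a (W p) p X)ᶜ ∧ ∀ x, ∀ v ∈ φ x, v = 0 := by
  -- An element `x` of block `m` exceeds `m`, and a record forces `2 * p ≤ m`, so the bounds lose
  -- nothing. The default `(0, [])` is excluded by `≠ none`.
  let R : ℕ → ℕ → List Bool → Prop := fun x s l =>
    x ≤ s ∧ ∀ p < x + 1, ∀ m < x + 1, InBlock m x → record a (W p) p m ≠ none →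
      ¬ Selected p ((record a (W p) p m).getD (0, [])).2 (l.take m) x
  have hR : PrimrecPred fun q : ℕ × ℕ × List Bool => R q.1 q.2.1 q.2.2 := by
    refine PrimrecPred.and
      (PrimrecRel.comp Primrec.nat_le Primrec.fst (Primrec.fst.comp Primrec.snd)) ?_
    refine primrecPred_ball_lt (α := ℕ × ℕ × List Bool) (R := fun q p => ∀ m < q.1 + 1,
      InBlock m q.1 → record a (W p) p m ≠ none →
        ¬ Selected p ((record a (W p) p m).getD (0, [])).2 (q.2.2.take m) q.1)
      (Primrec.succ.comp Primrec.fst) ?_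
    refine primrecPred_ball_lt (α := (ℕ × ℕ × List Bool) × ℕ) (R := fun q m =>
      InBlock m q.1.1 → record a (W q.2) q.2 m ≠ none →
        ¬ Selected q.2 ((record a (W q.2) q.2 m).getD (0, [])).2 (q.1.2.2.take m) q.1.1)
      (Primrec.succ.comp (Primrec.fst.comp Primrec.fst)) ?_
    have hx : Primrec fun q : ((ℕ × ℕ × List Bool) × ℕ) × ℕ => q.1.1.1 :=
      Primrec.fst.comp (Primrec.fst.comp Primrec.fst)
    have hl : Primrec fun q : ((ℕ × ℕ × List Bool) × ℕ) × ℕ => q.1.1.2.2 :=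
      Primrec.snd.comp (Primrec.snd.comp (Primrec.fst.comp Primrec.fst))
    have hp : Primrec fun q : ((ℕ × ℕ × List Bool) × ℕ) × ℕ => q.1.2 :=
      Primrec.snd.comp Primrec.fst
    have hr := primrec_record haP hWP hp Primrec.snd
    refine primrecPred_imp (primrecPred_inBlock Primrec.snd hx) (primrecPred_imp
      (PrimrecPred.not (PrimrecRel.comp Primrec.eq hr (Primrec.const none)))
      (PrimrecPred.not (primrecPred_selected hp ?_ ?_ hx)))
    · exact Primrec.snd.comp (Primrec.option_getD.comp hr (Primrec.const _))
    · exact Primrec.list_take.comp Primrec.snd hl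
  obtain ⟨φ, h1, h2, h3⟩ := exists_recursiveIn_dom X hR
  refine ⟨φ, h1, h2.trans ?_, h3⟩
  ext x
  constructor
  · rintro ⟨s, hxs, hs⟩ hx
    obtain ⟨p, m, v, L, hb, hr, hsel⟩ := Set.mem_iUnion.1 hx
    have hpm := (record_eq_some hr).1
    have hmx := hb.lt
    refine hs p (by omega) m (by omega) hb (by rw [hr]; simp) ?_
    rw [take_initSeg X (by omega), hr]
    exact hsel
  · intro hx
    refine ⟨x, le_rfl, fun p _ m hm hb hne hsel => hx ?_⟩
    obtain ⟨⟨v, L⟩, hr⟩ := Option.ne_none_iff_exists'.1 hne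
    rw [take_initSeg X (by omega), hr] at hsel
    exact Set.mem_iUnion.2 ⟨p, m, v, L, hb, hr, hsel⟩

/-- The set of the elements that are not chosen at some stage that approximates the first bits of
`A` correctly is recursively enumerable in `A`. -/
theorem exists_recursiveIn_chosen (haP : Primrec₂ a)
    (hWP : PrimrecPred fun q : ℕ × ℕ × ℕ => W q.1 q.2.1 q.2.2) (A : Set ℕ) :
    ∃ φ : ℕ →. ℕ, Nat.RecursiveIn {oracle A} φ ∧
      φ.Dom = {x | ∃ s, ∀ p m, 2 * p ≤ m → InBlock m x →
        m ≤ s ∧ approxSeg a s m = initSeg A m ∧ ¬ Chosen (W p) p m s x} ∧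
      ∀ x, ∀ v ∈ φ x, v = 0 := by
  let R : ℕ → ℕ → List Bool → Prop := fun x s l =>
    ∀ p < x + 1, ∀ m < x + 1, 2 * p ≤ m → InBlock m x →
      m ≤ s ∧ approxSeg a s m = l.take m ∧ ¬ Chosen (W p) p m s x
  have hR : PrimrecPred fun q : ℕ × ℕ × List Bool => R q.1 q.2.1 q.2.2 := by
    refine primrecPred_ball_lt (α := ℕ × ℕ × List Bool) (R := fun q p => ∀ m < q.1 + 1,
      2 * p ≤ m → InBlock m q.1 →
        m ≤ q.2.1 ∧ approxSeg a q.2.1 m = q.2.2.take m ∧ ¬ Chosen (W p) p m q.2.1 q.1)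
      (Primrec.succ.comp Primrec.fst) ?_
    refine primrecPred_ball_lt (α := (ℕ × ℕ × List Bool) × ℕ) (R := fun q m =>
      2 * q.2 ≤ m → InBlock m q.1.1 → m ≤ q.1.2.1 ∧ approxSeg a q.1.2.1 m = q.1.2.2.take m ∧
        ¬ Chosen (W q.2) q.2 m q.1.2.1 q.1.1)
      (Primrec.succ.comp (Primrec.fst.comp Primrec.fst)) ?_
    have hx : Primrec fun q : ((ℕ × ℕ × List Bool) × ℕ) × ℕ => q.1.1.1 :=
      Primrec.fst.comp (Primrec.fst.comp Primrec.fst)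
    have hs : Primrec fun q : ((ℕ × ℕ × List Bool) × ℕ) × ℕ => q.1.1.2.1 :=
      Primrec.fst.comp (Primrec.snd.comp (Primrec.fst.comp Primrec.fst))
    have hl : Primrec fun q : ((ℕ × ℕ × List Bool) × ℕ) × ℕ => q.1.1.2.2 :=
      Primrec.snd.comp (Primrec.snd.comp (Primrec.fst.comp Primrec.fst))
    have hp : Primrec fun q : ((ℕ × ℕ × List Bool) × ℕ) × ℕ => q.1.2 :=
      Primrec.snd.comp Primrec.fst
    refine primrecPred_imp (PrimrecRel.comp Primrec.nat_le
      (Primrec.nat_mul.comp (Primrec.const 2) hp) Primrec.snd) (primrecPred_imp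
        (primrecPred_inBlock Primrec.snd hx) (PrimrecPred.and ?_ (PrimrecPred.and ?_ ?_)))
    · exact PrimrecRel.comp Primrec.nat_le Primrec.snd hs
    · exact PrimrecRel.comp Primrec.eq (primrec_approxSeg haP hs Primrec.snd)
        (Primrec.list_take.comp Primrec.snd hl)
    · exact (primrecPred_chosen hWP hp Primrec.snd hs hx).not
  obtain ⟨φ, h1, h2, h3⟩ := exists_recursiveIn_dom A hR
  refine ⟨φ, h1, h2.trans ?_, h3⟩
  ext x
  refine exists_congr fun s => ?_
  constructor
  · intro h p m hpm hb
    have hmx := hb.lt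
    obtain ⟨g1, g2, g3⟩ := h p (by omega) m (by omega) hpm hb
    rw [take_initSeg A g1] at g2
    exact ⟨g1, g2, g3⟩
  · intro h p _ m _ hpm hb
    obtain ⟨g1, g2, g3⟩ := h p m hpm hb
    refine ⟨g1, ?_, g3⟩
    rw [take_initSeg A g1]
    exact g2

end Compute

/-! ### The main construction -/

/-- If `A` is nonrecursive and `Δ⁰₂`, and `B` is not `Δ⁰₂`, then there are sets of density `1`
that are recursively enumerable in `A` and in `B`, such that each recursively enumerable set of
density `1` has infinitely many elements outside their union. -/
theorem exists_generic_domains {A B : Set ℕ} (hA : IsDelta02 A) (hA' : ¬ IsRecursive A)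
    (hB : ¬ IsDelta02 B) :
    ∃ φ ψ : ℕ →. ℕ, Nat.RecursiveIn {oracle A} φ ∧ Nat.RecursiveIn {oracle B} ψ ∧
      HasDensityOne φ.Dom ∧ HasDensityOne ψ.Dom ∧ (∀ x, ∀ v ∈ φ x, v = 0) ∧
      (∀ x, ∀ v ∈ ψ x, v = 0) ∧
      ∀ c : Nat.Partrec.Code, HasDensityOne c.eval.Dom →
        ∃ᶠ x in atTop, x ∈ c.eval.Dom ∧ x ∉ φ.Dom ∧ x ∉ ψ.Dom := by
  obtain ⟨a, haP, ha⟩ := hA.exists_approx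
  -- Only the first component of `p` selects the program; the second provides infinitely many
  -- requirements for it.
  let W : ℕ → ℕ → ℕ → Prop := fun p s x =>
    (Nat.Partrec.Code.evaln s (Denumerable.ofNat Nat.Partrec.Code p.unpair.1) x).isSome = true
  have hWP : PrimrecPred fun q : ℕ × ℕ × ℕ => W q.1 q.2.1 q.2.2 := by
    refine PrimrecRel.comp Primrec.eq (Primrec.option_isSome.comp
      (Nat.Partrec.Code.primrec_evaln.comp (Primrec.pair (Primrec.pair ?_ ?_) ?_)))
      (Primrec.const true)
    · exact Primrec.fst.comp Primrec.snd
    · exact (Primrec.ofNat Nat.Partrec.Code).comp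
        (Primrec.fst.comp (Primrec.unpair.comp Primrec.fst))
    · exact Primrec.snd.comp Primrec.snd
  have hW : ∀ p, ∀ x s t, s ≤ t → W p s x → W p t x := by
    intro p x s t hst h
    obtain ⟨v, hv⟩ := Option.isSome_iff_exists.1 h
    exact Option.isSome_iff_exists.2 ⟨v, Nat.Partrec.Code.evaln_mono hst hv⟩
  have hrP : ∀ p, Primrec (record a (W p) p) := fun p =>
    primrec_record haP hWP (Primrec.const p) Primrec.id
  have hact : ∀ p, {m | Active a (W p) p B m}.Finite := by
    intro p
    by_contra hinf
    refine hB (isDelta02_of_infinite_active hA' haP (hrP p) ?_ ha (hW p) hinf)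
    exact primrec_scan_record haP hWP (p := fun _ : ℕ × ℕ => p) (Primrec.const p) Primrec.fst
      Primrec.snd
  obtain ⟨φ, hφ, hφd, hφ0⟩ := exists_recursiveIn_chosen haP hWP A
  obtain ⟨ψ, hψ, hψd, hψ0⟩ := exists_recursiveIn_omitted haP hWP B
  refine ⟨φ, ψ, hφ, hψ, ?_, ?_, hφ0, hψ0, ?_⟩
  · refine hasDensityOne_of_compl_subset (O := fun p => EverChosen (W p) p) ?_
      (fun p => tendsto_ncard_everChosen (hW p)) (fun p => ncard_everChosen_mul_le (hW p))
    intro x hx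
    by_contra hno
    refine hx ?_
    rw [hφd]
    obtain ⟨s, hs, hxs⟩ := ((eventually_approxSeg ha (Nat.log 2 x)).and
      (eventually_ge_atTop x)).exists
    refine ⟨s, fun p m hpm hb => ?_⟩
    have hm := Nat.log_eq_of_pow_le_of_lt_pow hb.1 hb.2
    rw [hm] at hs
    have := hb.lt
    exact ⟨by omega, hs, fun hc => hno (Set.mem_iUnion.2 ⟨p, m, s, hpm, hb, hc⟩)⟩
  · refine hasDensityOne_of_compl_subset (O := fun p => Omitted a (W p) p B) ?_
      (fun p => tendsto_ncard_div_zero_of_finite (finite_omitted (hact p)))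
      (fun p => ncard_omitted_mul_le)
    rw [hψd, compl_compl]
  · intro c hc
    have hdom : ∀ k x, x ∈ c.eval.Dom ↔ ∃ s, W (Nat.pair (Encodable.encode c) k) s x := by
      intro k x
      simp only [W, Nat.unpair_pair, Denumerable.ofNat_encode, Option.isSome_iff_exists]
      rw [PFun.mem_dom]
      constructor
      · rintro ⟨v, hv⟩
        obtain ⟨s, hs⟩ := Nat.Partrec.Code.evaln_complete.1 hv
        exact ⟨s, v, hs⟩
      · rintro ⟨s, v, hs⟩
        exact ⟨v, Nat.Partrec.Code.evaln_sound hs⟩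
    refine frequently_atTop.2 fun K => ?_
    obtain ⟨N, hN⟩ := exists_forall_responded (W := W (Nat.pair (Encodable.encode c) 0))
      (hW _) (fun x hx => (hdom 0 x).1 hx) hc
    -- `p ≥ N` makes every block from `2 * p` on respond, and `p ≥ K` puts the witness beyond `K`.
    let p := Nat.pair (Encodable.encode c) (max K N)
    have hpK : max K N ≤ p := Nat.right_le_pair _ _
    have hWp : W p = W (Nat.pair (Encodable.encode c) 0) := by
      simp only [W, p, Nat.unpair_pair]
    obtain ⟨m, x, hpm, hb, hxW, hch, v, L, hr, hsel⟩ := exists_mem_omitted hA' haP (hrP p) ha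
      (hW p) (hact p) fun m hm => by
        rw [hWp]
        exact hN m (by have := le_max_right K N; omega) p (by omega)
    have hmx := hb.lt
    refine ⟨x, by have := le_max_left K N; omega, (hdom _ x).2 hxW, ?_, ?_⟩
    · rw [hφd]
      rintro ⟨s, hs⟩
      obtain ⟨h1, h2, h3⟩ := hs p m hpm hb
      exact h3 (hch s h1 h2)
    · rw [hψd, Set.mem_compl_iff, not_not]
      exact Set.mem_iUnion.2 ⟨p, m, v, L, hb, hr, hsel⟩

/-- A `Δ⁰₂` set and a set that is not `Δ⁰₂` do not form a minimal pair for generic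
computability. -/
theorem IsDelta02.not_isMinimalPair {A B : Set ℕ} (hA : IsDelta02 A) (hB : ¬ IsDelta02 B) :
    ¬ IsMinimalPair A B := by
  rintro ⟨hA', -, hmin⟩
  obtain ⟨φ, ψ, hφ, hψ, hφd, hψd, hφ0, hψ0, hmeet⟩ := exists_generic_domains hA hA' hB
  have hfr : ∀ e, ∃ᶠ x in atTop,
      HasDensityOne (Denumerable.ofNat Nat.Partrec.Code e).eval.Dom →
        x ∈ (Denumerable.ofNat Nat.Partrec.Code e).eval.Dom ∧ x ∉ φ.Dom ∧ x ∉ ψ.Dom := by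
    intro e
    by_cases he : HasDensityOne (Denumerable.ofNat Nat.Partrec.Code e).eval.Dom
    · exact (hmeet _ he).mono fun x hx _ => hx
    · exact Frequently.of_forall fun x h => absurd h he
  obtain ⟨f, hf, hfe⟩ := extraction_forall_of_frequently hfr
  -- The point `f e` attacks program `e`: it is put in unless the program answers `1` there.
  -- Injectivity of `f` keeps the attacks apart.
  let C : Set ℕ := {x | ∃ e, x = f e ∧ x ∉ φ.Dom ∧ x ∉ ψ.Dom ∧
    1 ∉ (Denumerable.ofNat Nat.Partrec.Code e).eval x}
  have hzero : ∀ χ : ℕ →. ℕ, (∀ x, ∀ v ∈ χ x, v = 0) → (∀ x ∈ C, x ∉ χ.Dom) →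
      ∀ n, ∀ v ∈ χ n, v = charFun C n := by
    intro χ h0 hC n v hv
    have hn : n ∉ C := fun h => hC n h ((PFun.mem_dom _ _).2 ⟨v, hv⟩)
    rw [h0 n v hv, charFun, if_neg hn]
  obtain ⟨θ, hθ, hθd, hθC⟩ := hmin C
    ⟨φ, hφ, hφd, hzero φ hφ0 fun x ⟨_, _, h, _⟩ => h⟩
    ⟨ψ, hψ, hψd, hzero ψ hψ0 fun x ⟨_, _, _, h, _⟩ => h⟩
  obtain ⟨c, rfl⟩ := Nat.Partrec.Code.exists_code.1 hθ
  have hc : Denumerable.ofNat Nat.Partrec.Code (Encodable.encode c) = c :=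
    Denumerable.ofNat_encode c
  obtain ⟨h1, h2, h3⟩ := hfe (Encodable.encode c) (by rw [hc]; exact hθd)
  rw [hc] at h1
  obtain ⟨v, hv⟩ := (PFun.mem_dom _ _).1 h1
  have hvC := hθC _ v hv
  by_cases hx : f (Encodable.encode c) ∈ C
  · rw [charFun, if_pos hx] at hvC
    obtain ⟨e, he, -, -, hno⟩ := hx
    rw [← hf.injective he, hc] at hno
    exact hno (hvC ▸ hv)
  · rw [charFun, if_neg hx] at hvC
    refine hx ⟨_, rfl, h2, h3, fun h => ?_⟩
    rw [hc] at h
    have := Part.mem_unique h hv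
    omega

end GenericComputability

theorem mainTheorem5 (A B : Set ℕ)
    (hA : GenericComputability.IsDelta02 A) (hB : ¬ GenericComputability.IsDelta02 B) :
    ¬ GenericComputability.IsMinimalPair A B := by
  exact hA.not_isMinimalPair hB
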